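/- Let $M_n$ denote a random $n\times n$ real matrix whose $n^2$ entries are independent and take the values $1$ and $-1$ with probability $1/2$ each. (i) There is a sequence $\varepsilon_n\to 0$ such that for every $n$ and every fixed real $n\times n$ matrix $C$, $$\mathbb P\left(M_nM_n^T=M_n^TM_n+C\right)\le 2^{-(0.302+\varepsilon_n)n^2}.$$ (ii) Let $\nu_n:=\mathbb P(M_nM_n^T=M_n^TM_n)$ be the probability that $M_n$ is normal. There are sequences $\varepsilon_n'\to 0$ and $\varepsilon_n''\to 0$ such that for every $n$, $$2^{-(0.5+\varepsilon_n')n^2}\le \nu_n\le 2^{-(0.302+\varepsilon_n'')n^2}.$$ -/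

import Mathlib

open Filter Topology MeasureTheory ProbabilityTheory
open scoped Matrix

/-- The Rademacher distribution on the reals: the values 1 and -1 have probability 1/2 each. -/
noncomputable def rademacherLaw : Measure ℝ :=
  (2⁻¹ : ENNReal) • Measure.dirac (1 : ℝ) + (2⁻¹ : ENNReal) • Measure.dirac (-1 : ℝ)

/-- A random `n × n` real matrix `M`, defined on a space `Ω` with measure `μ`, is a Rademacher
matrix if its `n ^ 2` entries are jointly independent and each has the Rademacher distribution. -/
structure IsRademacherMatrix {Ω : Type*} [MeasurableSpace Ω] {n : ℕ}
    (M : Ω → Matrix (Fin n) (Fin n) ℝ) (μ : Measure Ω) : Prop where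
  indep : iIndepFun (fun (p : Fin n × Fin n) (ω : Ω) => M ω p.1 p.2) μ
  law : ∀ i j : Fin n, HasLaw (fun ω => M ω i j) rademacherLaw μ

/-! The event has probability 2^(-n²) times the number of sign matrices `M` with M Mᵀ - Mᵀ M = C, so
the theorem is a counting problem. Symmetric sign matrices give the lower bound. For the upper bound
it suffices to count at most 2^(0.698 n² + O(n log n)) solutions, uniformly in `C`.

Row `j` of `wide M` joins row `j` and column `j` of `M`. Once the rows and columns in `A` are known,
the equations (i, j) with j ∈ A are linear in the unknown entries of row and column `i`; their
coefficients are the rows in `A` of `wide M` outside `A` and `i`. By Odlyzko's lemma, high rank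
leaves few choices. If the rank is already as large as it can get, the new row instead lies in a
known low-dimensional row space, which again leaves few choices.

Let h be the largest rank of a block A × Aᶜ of `wide M`, attained at a set P that is as large as
possible, and let t = n - |P|. A nonsingular h × h block K × B is fixed inside P × Pᶜ. Maximality of
P forces each index outside P to have one (single) or both (double) of its columns in B, so with s
singles and d doubles h = s + 2d and t = s + d. Two bounds follow. `card_le_of_reveal` reveals K, P
\ K, the singles and the doubles in turn. `card_le_of_recursion` fills the blocks between P and Pᶜ,
where the relations among columns are very restricted, and treats the P × P block as a smaller
instance of the same problem. For every pair (h, t) one of the two gives exponent 0.698 n² to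
leading order. The data P, K, B and the slopes ν number 2^(O(n log n)), so a union bound over them
is affordable. -/

set_option linter.unusedSectionVars false

/-! ### Odlyzko's lemma on sign vectors in affine subspaces. -/

section Odlyzko

/-- In a subspace of dimension `r`, some `r` coordinates determine all the others. -/
theorem Submodule.exists_determining_coords {J : Type*} [Fintype J] (V : Submodule ℝ (J → ℝ)) :
    ∃ I : Finset J, I.card ≤ Module.finrank ℝ V ∧ ∀ v ∈ V, (∀ q ∈ I, v q = 0) → v = 0 := by
  classical
  -- A maximal independent family of coordinate functionals on `V`; it has at most dim V members and
  -- spans all the others.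
  obtain ⟨κ, a, ha, hspan, hli⟩ := exists_linearIndependent' ℝ
    (fun q : J => (LinearMap.proj q : (J → ℝ) →ₗ[ℝ] ℝ).comp V.subtype)
  have : Finite κ := Finite.of_injective a ha
  have : Fintype κ := Fintype.ofFinite κ
  refine ⟨Finset.univ.image a, ?_, ?_⟩
  · refine Finset.card_image_le.trans ?_
    rw [Finset.card_univ]
    refine hli.fintype_card_le_finrank.trans ?_
    exact (Subspace.dual_finrank_eq (K := ℝ) (V := V)).le
  · intro v hv h0
    have key : ∀ f ∈ Submodule.span ℝ (Set.range
        (fun q : J => (LinearMap.proj q : (J → ℝ) →ₗ[ℝ] ℝ).comp V.subtype)), f ⟨v, hv⟩ = 0 := by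
      rw [← hspan]
      intro f hf
      induction hf using Submodule.span_induction with
      | mem x hx =>
        obtain ⟨k, rfl⟩ := hx
        exact h0 (a k) (by simp)
      | zero => simp
      | add x y _ _ hx hy => simp [hx, hy]
      | smul c x _ hx => simp [hx]
    funext q
    exact key _ (Submodule.subset_span ⟨q, rfl⟩)

/-- Odlyzko's lemma: an affine subspace of dimension `r` contains at most `2 ^ r` vectors
each of whose coordinates takes two prescribed opposite values. -/
theorem card_le_two_pow_finrank {J : Type*} [Fintype J] (X : Finset (J → ℝ)) (a : J → ℝ)
    (hX : ∀ x ∈ X, ∀ q, x q = a q ∨ x q = -a q) (V : Submodule ℝ (J → ℝ))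
    (hV : ∀ x ∈ X, ∀ y ∈ X, x - y ∈ V) : X.card ≤ 2 ^ Module.finrank ℝ V := by
  classical
  obtain ⟨I, hI, hI0⟩ := V.exists_determining_coords
  have hinj : Set.InjOn (fun (x : J → ℝ) (q : I) => decide (x q = a q)) X := by
    intro x hx y hy hxy
    have : x - y = 0 := by
      refine hI0 _ (hV x hx y hy) fun q hq => ?_
      have h1 := congrFun hxy ⟨q, hq⟩
      simp only [decide_eq_decide] at h1
      have h2 := hX x hx q
      have h3 := hX y hy q
      simp only [Pi.sub_apply, sub_eq_zero]
      by_cases h : x q = a q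
      · rw [h, h1.1 h]
      · rw [h2.resolve_left h, h3.resolve_left (fun h' => h (h1.2 h'))]
    exact sub_eq_zero.1 this
  calc X.card ≤ (Finset.univ : Finset (I → Bool)).card :=
        Finset.card_le_card_of_injOn _ (by simp) hinj
    _ = 2 ^ I.card := by simp
    _ ≤ _ := Nat.pow_le_pow_right (by norm_num) hI

end Odlyzko

/-! ### Ranks, row spaces and kernels of blocks of a matrix. -/

section BlockRank

variable {α β : Type*} [Fintype α] [Fintype β] [DecidableEq α] [DecidableEq β]

/-- A vector with the coordinates outside `Q` replaced by zero. -/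
def maskVec (Q : Finset β) (v : β → ℝ) : β → ℝ := fun q => if q ∈ Q then v q else 0

/-- A matrix with the entries outside the block `A × Q` replaced by zero. -/
def blockMask (X : Matrix α β ℝ) (A : Finset α) (Q : Finset β) : Matrix α β ℝ :=
  Matrix.of fun i q => if i ∈ A ∧ q ∈ Q then X i q else 0

/-- The rank of the block `A × Q` of a matrix. -/
noncomputable def blockRank (X : Matrix α β ℝ) (A : Finset α) (Q : Finset β) : ℕ :=
  (blockMask X A Q).rank

/-- The row space of the block `A × Q` of a matrix. -/
def rowSpace (X : Matrix α β ℝ) (A : Finset α) (Q : Finset β) : Submodule ℝ (β → ℝ) :=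
  Submodule.span ℝ ((fun i => maskVec Q (X i)) '' A)

theorem rowSpace_mono_left (X : Matrix α β ℝ) {A A' : Finset α} (h : A ⊆ A') (Q : Finset β) :
    rowSpace X A Q ≤ rowSpace X A' Q :=
  Submodule.span_mono (Set.image_mono (by exact_mod_cast h))

theorem blockRank_eq_finrank_rowSpace (X : Matrix α β ℝ) (A : Finset α) (Q : Finset β) :
    blockRank X A Q = Module.finrank ℝ (rowSpace X A Q) := by
  unfold blockRank
  rw [Matrix.rank_eq_finrank_span_row]
  suffices h : Submodule.span ℝ (Set.range (blockMask X A Q).row) = rowSpace X A Q by rw [h]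
  apply le_antisymm
  · rw [Submodule.span_le]
    rintro _ ⟨i, rfl⟩
    by_cases hi : i ∈ A
    · apply Submodule.subset_span
      exact ⟨i, hi, by funext q; simp [blockMask, maskVec, Matrix.row, hi]⟩
    · have : (blockMask X A Q).row i = 0 := by funext q; simp [blockMask, Matrix.row, hi]
      rw [this]
      exact Submodule.zero_mem _
  · rw [rowSpace, Submodule.span_le]
    rintro _ ⟨i, hi, rfl⟩
    apply Submodule.subset_span
    exact ⟨i, by funext q; simp [blockMask, maskVec, Matrix.row, Finset.mem_coe.1 hi]⟩

theorem blockRank_transpose (X : Matrix α β ℝ) (A : Finset α) (Q : Finset β) :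
    blockRank Xᵀ Q A = blockRank X A Q := by
  unfold blockRank
  rw [← Matrix.rank_transpose]
  congr 1
  ext i q
  simp [blockMask, and_comm]

theorem rowSpace_congr {X Y : Matrix α β ℝ} {A : Finset α} {Q : Finset β}
    (h : ∀ i ∈ A, ∀ q ∈ Q, X i q = Y i q) : rowSpace X A Q = rowSpace Y A Q := by
  unfold rowSpace
  congr 1
  apply Set.image_congr
  intro i hi
  funext q
  simp only [maskVec]
  split_ifs with h'
  · exact h i hi q h'
  · rfl

theorem blockRank_mono_left (X : Matrix α β ℝ) {A A' : Finset α} (h : A ⊆ A') (Q : Finset β) :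
    blockRank X A Q ≤ blockRank X A' Q := by
  rw [blockRank_eq_finrank_rowSpace, blockRank_eq_finrank_rowSpace]
  exact Submodule.finrank_mono (rowSpace_mono_left X h Q)

theorem blockRank_mono (X : Matrix α β ℝ) {A A' : Finset α} {Q Q' : Finset β} (h : A ⊆ A')
    (h' : Q ⊆ Q') : blockRank X A Q ≤ blockRank X A' Q' := by
  refine (blockRank_mono_left X h Q).trans ?_
  rw [← blockRank_transpose X, ← blockRank_transpose X]
  exact blockRank_mono_left _ h' _

theorem blockRank_le_add_card_left (X : Matrix α β ℝ) (A A' : Finset α) (Q : Finset β) :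
    blockRank X A Q ≤ blockRank X A' Q + (A \ A').card := by
  rw [blockRank_eq_finrank_rowSpace, blockRank_eq_finrank_rowSpace]
  have h1 : rowSpace X A Q ≤ rowSpace X A' Q ⊔ rowSpace X (A \ A') Q := by
    rw [rowSpace, rowSpace, rowSpace, ← Submodule.span_union, ← Set.image_union]
    apply Submodule.span_mono
    apply Set.image_mono
    intro x hx
    by_cases h : x ∈ A' <;> simp_all
  refine (Submodule.finrank_mono h1).trans
    ((Submodule.finrank_add_le_finrank_add_finrank _ _).trans ?_)
  gcongr
  rw [rowSpace, ← Finset.coe_image]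
  exact (finrank_span_finset_le_card _).trans Finset.card_image_le

theorem blockRank_le_add_card_right (X : Matrix α β ℝ) (A : Finset α) (Q Q' : Finset β) :
    blockRank X A Q ≤ blockRank X A Q' + (Q \ Q').card := by
  rw [← blockRank_transpose X, ← blockRank_transpose X]
  exact blockRank_le_add_card_left _ _ _ _

theorem blockRank_le_card_left (X : Matrix α β ℝ) (A : Finset α) (Q : Finset β) :
    blockRank X A Q ≤ A.card := by
  rw [blockRank_eq_finrank_rowSpace, rowSpace, ← Finset.coe_image]
  exact (finrank_span_finset_le_card _).trans Finset.card_image_le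

theorem blockRank_le_card_right (X : Matrix α β ℝ) (A : Finset α) (Q : Finset β) :
    blockRank X A Q ≤ Q.card := by
  rw [← blockRank_transpose X]
  exact blockRank_le_card_left _ _ _

theorem exists_rows_card_eq_blockRank (X : Matrix α β ℝ) (A : Finset α) (Q : Finset β) :
    ∃ K ⊆ A, K.card = blockRank X A Q ∧ blockRank X K Q = blockRank X A Q := by
  obtain ⟨κ, a, ha, hspan, hli⟩ := exists_linearIndependent' ℝ
    (fun i : A => maskVec Q (X i))
  have : Finite κ := Finite.of_injective a ha
  have : Fintype κ := Fintype.ofFinite κ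
  set K : Finset α := Finset.univ.image (fun k => (a k : α)) with hK
  have hKA : K ⊆ A := by
    intro x hx
    simp only [hK, Finset.mem_image] at hx
    obtain ⟨k, -, rfl⟩ := hx
    exact (a k).2
  have h1 : rowSpace X A Q =
      Submodule.span ℝ (Set.range ((fun i : A => maskVec Q (X i)) ∘ a)) := by
    rw [hspan, rowSpace]
    congr 1
    ext v
    simp
  have h2 : rowSpace X A Q = rowSpace X K Q := by
    rw [h1, rowSpace]
    congr 1
    ext v
    simp [hK]
  have hc : K.card = Fintype.card κ := by
    rw [hK, Finset.card_image_of_injective, Finset.card_univ]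
    exact Subtype.val_injective.comp ha
  refine ⟨K, hKA, ?_, ?_⟩
  · rw [blockRank_eq_finrank_rowSpace, h1, finrank_span_eq_card hli, hc]
  · rw [blockRank_eq_finrank_rowSpace, blockRank_eq_finrank_rowSpace, h2]

theorem exists_cols_card_eq_blockRank (X : Matrix α β ℝ) (A : Finset α) (Q : Finset β) :
    ∃ B ⊆ Q, B.card = blockRank X A Q ∧ blockRank X A B = blockRank X A Q := by
  obtain ⟨B, hB, h1, h2⟩ := exists_rows_card_eq_blockRank Xᵀ Q A
  rw [blockRank_transpose] at h1 h2
  rw [blockRank_transpose] at h2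
  exact ⟨B, hB, h1, h2⟩

/-- The vectors supported on `Q`. -/
def supportedOn (Q : Finset β) : Submodule ℝ (β → ℝ) where
  carrier := {y | ∀ q ∉ Q, y q = 0}
  add_mem' := fun ha hb q hq => by simp [ha q hq, hb q hq]
  zero_mem' := fun _ _ => rfl
  smul_mem' := fun c x hx q hq => by simp [hx q hq]

theorem finrank_supportedOn_le (Q : Finset β) : Module.finrank ℝ (supportedOn Q) ≤ Q.card := by
  have : supportedOn Q ≤ Submodule.span ℝ
      ((Q.image fun q => (Pi.single q 1 : β → ℝ) : Finset _) : Set (β → ℝ)) := by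
    intro y hy
    have : y = ∑ q ∈ Q, y q • (Pi.single q 1 : β → ℝ) := by
      funext p
      simp only [Finset.sum_apply, Pi.smul_apply, Pi.single_apply, smul_eq_mul, mul_ite, mul_one,
        mul_zero, Finset.sum_ite_eq]
      split_ifs with h
      · rfl
      · exact hy p h
    rw [this]
    refine Submodule.sum_mem _ fun q hq => Submodule.smul_mem _ _ (Submodule.subset_span ?_)
    simp only [Finset.coe_image, Set.mem_image]
    exact ⟨q, hq, rfl⟩
  exact (Submodule.finrank_mono this).trans
    ((finrank_span_finset_le_card _).trans Finset.card_image_le)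

/-- The vectors supported on `Q` and orthogonal to the rows in `A`. -/
def blockKer (X : Matrix α β ℝ) (A : Finset α) (Q : Finset β) : Submodule ℝ (β → ℝ) where
  carrier := {y | (∀ q ∉ Q, y q = 0) ∧ ∀ i ∈ A, ∑ q ∈ Q, X i q * y q = 0}
  add_mem' := fun ha hb => ⟨fun q hq => by simp [ha.1 q hq, hb.1 q hq],
    fun i hi => by simp [mul_add, Finset.sum_add_distrib, ha.2 i hi, hb.2 i hi]⟩
  zero_mem' := by simp
  smul_mem' := fun c x hx => ⟨fun q hq => by simp [hx.1 q hq],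
    fun i hi => by
      have := hx.2 i hi
      simp only [Pi.smul_apply, smul_eq_mul, mul_left_comm _ c, ← Finset.mul_sum, this, mul_zero]⟩

/-- Kernel and row space are orthogonal, hence meet trivially, and both lie in the space of vectors
supported on `Q`. -/
theorem finrank_blockKer_add_blockRank_le (X : Matrix α β ℝ) (A : Finset α) (Q : Finset β) :
    Module.finrank ℝ (blockKer X A Q) + blockRank X A Q ≤ Q.card := by
  rw [blockRank_eq_finrank_rowSpace]
  have hdisj : blockKer X A Q ⊓ rowSpace X A Q = ⊥ := by
    rw [eq_bot_iff]
    rintro y ⟨hy1, hy2⟩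
    have key : ∀ z ∈ rowSpace X A Q, ∑ q, z q * y q = 0 := by
      intro z hz
      induction hz using Submodule.span_induction with
      | mem x hx =>
        obtain ⟨i, hi, rfl⟩ := hx
        simpa [maskVec, ite_mul, Finset.sum_ite_mem] using hy1.2 i hi
      | zero => simp
      | add x y _ _ hx hy => simp [add_mul, Finset.sum_add_distrib, hx, hy]
      | smul c x _ hx => simp [mul_assoc, ← Finset.mul_sum, hx]
    have h0 := key y hy2
    rw [Finset.sum_eq_zero_iff_of_nonneg (fun q _ => mul_self_nonneg (y q))] at h0
    rw [Submodule.mem_bot]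
    funext q
    simpa using h0 q (Finset.mem_univ q)
  have hsup : blockKer X A Q ⊔ rowSpace X A Q ≤ supportedOn Q := by
    refine sup_le (fun y hy => hy.1) ?_
    rw [rowSpace, Submodule.span_le]
    rintro _ ⟨i, -, rfl⟩ q hq
    simp [maskVec, hq]
  have := Submodule.finrank_sup_add_finrank_inf_eq (blockKer X A Q) (rowSpace X A Q)
  rw [hdisj, finrank_bot, add_zero] at this
  rw [← this]
  exact (Submodule.finrank_mono hsup).trans (finrank_supportedOn_le Q)

end BlockRank

/-! ### Counting images fibre by fibre, and telescoping such bounds. -/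

section Counting

theorem Finset.card_image_le_card_image_of_factors {α β γ : Type*} [DecidableEq β]
    [DecidableEq γ] (s : Finset α) (ψ : α → β) (φ : α → γ)
    (h : ∀ x ∈ s, ∀ y ∈ s, φ x = φ y → ψ x = ψ y) : (s.image ψ).card ≤ (s.image φ).card := by
  have h1 : s.image ψ ⊆ (s.image fun x => (φ x, ψ x)).image Prod.snd := by
    rw [Finset.image_image]; rfl
  have h2 : (s.image fun x => (φ x, ψ x)).card ≤ (s.image φ).card := by
    apply Finset.card_le_card_of_injOn Prod.fst
    · intro x hx
      simp only [Finset.coe_image, Set.mem_image] at hx ⊢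
      obtain ⟨y, hy, rfl⟩ := hx
      exact ⟨y, hy, rfl⟩
    · intro x hx y hy hxy
      simp only [Finset.coe_image, Set.mem_image] at hx hy
      obtain ⟨x, hx, rfl⟩ := hx
      obtain ⟨y, hy, rfl⟩ := hy
      exact Prod.ext hxy (h x hx y hy hxy)
  exact (Finset.card_le_card h1).trans (Finset.card_image_le.trans h2)

theorem Finset.card_image_le_mul_card_image {α β γ : Type*} [DecidableEq β] [DecidableEq γ]
    (s : Finset α) (ψ : α → β) (φ : α → γ) (c : ℕ)
    (hc : ∀ x ∈ s, ((s.filter fun y => φ y = φ x).image ψ).card ≤ c) :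
    (s.image ψ).card ≤ c * (s.image φ).card := by
  refine (s.card_image_le_card_image_of_factors ψ (fun x => (φ x, ψ x)) fun x _ y _ h =>
    (Prod.mk.inj h).2).trans ?_
  have h1 := Finset.card_le_mul_card_image (f := Prod.fst) (s.image fun x => (φ x, ψ x)) c ?_
  · rw [Finset.image_image] at h1
    exact h1
  · intro b hb
    rw [Finset.image_image] at hb
    obtain ⟨x, hx, rfl⟩ := Finset.mem_image.1 hb
    refine le_trans ?_ (hc x hx)
    apply Finset.card_le_card_of_injOn Prod.snd
    · intro y hy
      simp only [Finset.coe_filter, Finset.mem_image, Set.mem_ofPred_eq] at hy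
      obtain ⟨⟨z, hz, rfl⟩, hzx⟩ := hy
      simp only [Finset.coe_image, Set.mem_image, Finset.coe_filter, Set.mem_ofPred_eq]
      exact ⟨z, ⟨hz, hzx⟩, rfl⟩
    · intro y hy z hz hyz
      simp only [Finset.coe_filter, Set.mem_ofPred_eq] at hy hz
      exact Prod.ext (hy.2.trans hz.2.symm) hyz

/-- The cost of a step depends only on how many elements have been inserted, so the steps telescope
in any order. `Φ` may grow faster than the sum of the costs, which lets callers choose a convenient
polynomial. -/
theorem Finset.le_two_rpow_of_insert {ι : Type*} [DecidableEq ι] (F : Finset ι → ℕ)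
    (B Q : Finset ι) (Φ δ : ℕ → ℝ) (h0 : 0 ≤ Φ 0) (hΦ : ∀ k < Q.card, Φ k + δ k ≤ Φ (k + 1))
    (hF : ∀ A ⊆ Q, ∀ i ∈ Q, i ∉ A →
      (F (insert i (B ∪ A)) : ℝ) ≤ 2 ^ δ A.card * F (B ∪ A)) :
    (F (B ∪ Q) : ℝ) ≤ 2 ^ Φ Q.card * F B := by
  have key : ∀ A ⊆ Q, (F (B ∪ A) : ℝ) ≤ 2 ^ Φ A.card * F B := by
    intro A
    induction A using Finset.induction_on with
    | empty =>
      intro _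
      rw [Finset.union_empty, Finset.card_empty]
      exact le_mul_of_one_le_left (by positivity) (Real.one_le_rpow (by norm_num) h0)
    | insert i A hi ih =>
      intro hA
      obtain ⟨hiQ, hAQ⟩ := Finset.insert_subset_iff.1 hA
      rw [Finset.card_insert_of_notMem hi, Finset.union_insert]
      have hlt : A.card < Q.card :=
        Finset.card_lt_card ⟨hAQ, fun h => hi (h hiQ)⟩
      calc (F (insert i (B ∪ A)) : ℝ) ≤ 2 ^ δ A.card * F (B ∪ A) := hF A hAQ i hiQ hi
        _ ≤ 2 ^ δ A.card * (2 ^ Φ A.card * F B) := by gcongr; exact ih hAQ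
        _ = 2 ^ (Φ A.card + δ A.card) * F B := by
          rw [add_comm, Real.rpow_add (by norm_num), mul_assoc]
        _ ≤ _ := by
          gcongr
          · norm_num
          · exact hΦ _ hlt
  exact key Q subset_rfl

end Counting

/-! ### Revealing a matrix one row and column at a time. -/

section Reveal

variable {ι : Type*} [Fintype ι] [DecidableEq ι]

/-- The square matrices with entries `1` and `-1`. -/
noncomputable def signMatrices (ι : Type*) [Fintype ι] [DecidableEq ι] : Finset (Matrix ι ι ℝ) :=
  (Fintype.piFinset fun _ : ι => Fintype.piFinset fun _ : ι => ({1, -1} : Finset ℝ))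

theorem mem_signMatrices {M : Matrix ι ι ℝ} :
    M ∈ signMatrices ι ↔ ∀ i j, M i j = 1 ∨ M i j = -1 := by
  refine (Fintype.mem_piFinset (f := M)).trans (forall_congr' fun i => ?_)
  simp [Fintype.mem_piFinset]

open Classical in
/-- The sign matrices `M` with `M * Mᵀ = Mᵀ * M + C`. -/
noncomputable def commutatorSolutions (C : Matrix ι ι ℝ) : Finset (Matrix ι ι ℝ) :=
  (signMatrices ι).filter fun M => M * Mᵀ = Mᵀ * M + C

theorem mem_commutatorSolutions {C M : Matrix ι ι ℝ} :
    M ∈ commutatorSolutions C ↔ M ∈ signMatrices ι ∧ M * Mᵀ = Mᵀ * M + C := by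
  simp [commutatorSolutions]

theorem commutatorSolutions_apply {C M : Matrix ι ι ℝ} (h : M ∈ commutatorSolutions C) (i j : ι) :
    ∑ l, (M i l * M j l - M l i * M l j) = C i j := by
  have := congrFun (congrFun (mem_commutatorSolutions.1 h).2 i) j
  simp only [Matrix.mul_apply, Matrix.transpose_apply, Matrix.add_apply] at this
  rw [Finset.sum_sub_distrib, this]
  ring

/-- Row `j` of `wide M` consists of the `j`-th row and the `j`-th column of `M`. -/
def wide (M : Matrix ι ι ℝ) : Matrix ι (ι × Bool) ℝ :=
  Matrix.of fun j q => if q.2 then M q.1 j else M j q.1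

/-- The matrix `M` with the entries outside the rows and columns in `A` replaced by zero. -/
def reveal (A : Finset ι) (M : Matrix ι ι ℝ) : Matrix ι ι ℝ :=
  Matrix.of fun i j => if i ∈ A ∨ j ∈ A then M i j else 0

theorem reveal_eq_iff {A : Finset ι} {M N : Matrix ι ι ℝ} :
    reveal A M = reveal A N ↔ ∀ i j, i ∈ A ∨ j ∈ A → M i j = N i j := by
  constructor
  · intro h i j hij
    have := congrFun (congrFun h i) j
    simpa [reveal, hij] using this
  · intro h
    ext i j
    simp only [reveal, Matrix.of_apply]
    split_ifs with hij
    · exact h i j hij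
    · rfl

open Classical in
/-- The number of ways in which the rows and columns in `A` can be filled. -/
noncomputable def revealCount (S : Finset (Matrix ι ι ℝ)) (A : Finset ι) : ℕ :=
  (S.image (reveal A)).card

theorem revealCount_empty_le (S : Finset (Matrix ι ι ℝ)) : revealCount S ∅ ≤ 1 := by
  classical
  unfold revealCount
  rw [Finset.card_le_one]
  intro a ha b hb
  obtain ⟨M, -, rfl⟩ := Finset.mem_image.1 ha
  obtain ⟨N, -, rfl⟩ := Finset.mem_image.1 hb
  exact reveal_eq_iff.2 (by simp)

theorem revealCount_univ (S : Finset (Matrix ι ι ℝ)) : revealCount S Finset.univ = S.card := by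
  classical
  unfold revealCount
  rw [Finset.card_image_of_injOn]
  intro M _ N _ h
  ext i j
  exact reveal_eq_iff.1 h i j (by simp)

/-- The entries of row `i` and column `i` with second index in `R`; those in the column
are multiplied by `ε`. -/
def crossVec (ε : ℝ) (R : Finset ι) (i : ι) (M : Matrix ι ι ℝ) : ι × Bool → ℝ :=
  fun q => if q.1 ∈ R then (if q.2 then ε * M q.1 i else M i q.1) else 0

/-- The new data are the diagonal entry, which gives the factor 2, and the cross vector. Its
coordinates take two opposite values for either sign `ε`, so Odlyzko's lemma applies to it. The sign
-1 turns the commutator equations into dot products; the sign 1 gives row `i` of `wide M` itself. -/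
theorem revealCount_insert_le (S : Finset (Matrix ι ι ℝ)) (hS : S ⊆ signMatrices ι) (ε : ℝ)
    (hε : ε = 1 ∨ ε = -1) (A : Finset ι) (i : ι) (δ : ℕ)
    (h : ∀ M₀ ∈ S, ∃ V : Submodule ℝ (ι × Bool → ℝ), Module.finrank ℝ V ≤ δ ∧
      ∀ M ∈ S, ∀ N ∈ S, reveal A M = reveal A M₀ → reveal A N = reveal A M₀ →
        M i i = N i i → crossVec ε (insert i A)ᶜ i M - crossVec ε (insert i A)ᶜ i N ∈ V) :
    revealCount S (insert i A) ≤ (2 * 2 ^ δ) * revealCount S A := by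
  classical
  have hε0 : ε ≠ 0 := by rcases hε with rfl | rfl <;> norm_num
  unfold revealCount
  apply Finset.card_image_le_mul_card_image
  intro M₀ hM₀
  obtain ⟨V, hV, hdiff⟩ := h M₀ hM₀
  set S' := S.filter fun M => reveal A M = reveal A M₀ with hS'
  have h1 : (S'.image (reveal (insert i A))).card ≤
      (S'.image fun M => (M i i, crossVec ε (insert i A)ᶜ i M)).card := by
    apply Finset.card_image_le_card_image_of_factors
    intro M hM N hN hMN
    obtain ⟨hii, hvec⟩ := Prod.mk.inj hMN
    have hAA := reveal_eq_iff.1 ((Finset.mem_filter.1 hM).2.trans (Finset.mem_filter.1 hN).2.symm)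
    rw [reveal_eq_iff]
    have hrow : ∀ j, M i j = N i j := by
      intro j
      by_cases hj : j ∈ insert i A
      · rcases Finset.mem_insert.1 hj with rfl | hj
        · exact hii
        · exact hAA _ _ (Or.inr hj)
      · have := congrFun hvec (j, false)
        simpa only [crossVec, Finset.mem_compl, hj, not_false_eq_true, if_true,
          Bool.false_eq_true, if_false] using this
    have hcol : ∀ j, M j i = N j i := by
      intro j
      by_cases hj : j ∈ insert i A
      · rcases Finset.mem_insert.1 hj with rfl | hj
        · exact hii
        · exact hAA _ _ (Or.inl hj)
      · have := congrFun hvec (j, true)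
        simp only [crossVec, Finset.mem_compl, hj, not_false_eq_true, if_true] at this
        exact mul_left_cancel₀ hε0 this
    intro k j hkj
    rcases hkj with hk | hj
    · rcases Finset.mem_insert.1 hk with rfl | hk
      · exact hrow j
      · exact hAA _ _ (Or.inl hk)
    · rcases Finset.mem_insert.1 hj with rfl | hj
      · exact hcol k
      · exact hAA _ _ (Or.inr hj)
  have h2 : S'.image (fun M => (M i i, crossVec ε (insert i A)ᶜ i M)) ⊆
      ({1, -1} : Finset ℝ).biUnion fun a =>
        ((S'.filter fun M => M i i = a).image (crossVec ε (insert i A)ᶜ i)).image (Prod.mk a) := by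
    intro x hx
    obtain ⟨M, hM, rfl⟩ := Finset.mem_image.1 hx
    rw [Finset.mem_biUnion]
    refine ⟨M i i, ?_, ?_⟩
    · have := mem_signMatrices.1 (hS (Finset.mem_filter.1 hM).1) i i
      simpa using this
    · exact Finset.mem_image_of_mem _ (Finset.mem_image_of_mem _ (Finset.mem_filter.2 ⟨hM, rfl⟩))
  refine h1.trans ((Finset.card_le_card h2).trans ((Finset.card_biUnion_le_card_mul _ _ (2 ^ δ)
    ?_).trans ?_))
  · intro a _
    refine Finset.card_image_le.trans ?_
    refine (card_le_two_pow_finrank _ (fun q => if q.1 ∈ (insert i A)ᶜ then 1 else 0) ?_ V ?_).trans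
      (Nat.pow_le_pow_right (by norm_num) hV)
    · intro x hx q
      obtain ⟨M, hM, rfl⟩ := Finset.mem_image.1 hx
      have hM := hS (Finset.mem_filter.1 (Finset.mem_filter.1 hM).1).1
      rw [mem_signMatrices] at hM
      unfold crossVec
      split_ifs with hq hq2
      · rcases hM q.1 i with h' | h' <;> rcases hε with rfl | rfl <;> simp only [h'] <;> norm_num
      · exact hM i q.1
      · simp
    · intro x hx y hy
      obtain ⟨M, hM, rfl⟩ := Finset.mem_image.1 hx
      obtain ⟨N, hN, rfl⟩ := Finset.mem_image.1 hy
      simp only [hS', Finset.mem_filter] at hM hN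
      exact hdiff M hM.1.1 N hN.1.1 hM.1.2 hN.1.2 (hM.2.trans hN.2.symm)
  · gcongr
    exact Finset.card_le_two

theorem card_prod_bool (R : Finset ι) :
    (R ×ˢ (Finset.univ : Finset Bool)).card = 2 * R.card := by
  rw [Finset.card_product, Finset.card_univ, Fintype.card_bool, mul_comm]

/-- Revealing one more row and column when the equations with the revealed rows have rank at
least `r`. -/
theorem revealCount_insert_le_of_rank (C : Matrix ι ι ℝ) (S : Finset (Matrix ι ι ℝ))
    (hS : S ⊆ commutatorSolutions C) (A : Finset ι) (i : ι) (r : ℕ)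
    (hr : ∀ M ∈ S, r ≤ blockRank (wide M) A ((insert i A)ᶜ ×ˢ Finset.univ)) :
    revealCount S (insert i A) ≤ (2 * 2 ^ (2 * (insert i A)ᶜ.card - r)) * revealCount S A := by
  classical
  apply revealCount_insert_le S (fun M hM => (mem_commutatorSolutions.1 (hS hM)).1) (-1)
    (Or.inr rfl)
  intro M₀ hM₀
  refine ⟨blockKer (wide M₀) A ((insert i A)ᶜ ×ˢ Finset.univ), ?_, ?_⟩
  · have h1 := finrank_blockKer_add_blockRank_le (wide M₀) A ((insert i A)ᶜ ×ˢ Finset.univ)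
    have h2 := hr M₀ hM₀
    rw [card_prod_bool] at h1
    omega
  · intro M hM N hN hMA hNA hii
    rw [reveal_eq_iff] at hMA hNA
    refine ⟨?_, ?_⟩
    · intro q hq
      have : q.1 ∉ (insert i A)ᶜ := by simpa using hq
      simp only [Pi.sub_apply, crossVec, this, if_false, sub_self]
    · intro j hj
      -- Equation (i, j), with the terms in which both factors are known (given the diagonal entry)
      -- moved to the right. Two solutions therefore differ by a kernel vector.
      have key : ∀ L ∈ S, (∀ k l, k ∈ A ∨ l ∈ A → L k l = M₀ k l) →
          ∑ q ∈ (insert i A)ᶜ ×ˢ (Finset.univ : Finset Bool),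
            wide M₀ j q * crossVec (-1) (insert i A)ᶜ i L q =
          C i j - ∑ l ∈ insert i A, (L i l * L j l - L l i * L l j) := by
        intro L hL hLA
        rw [← commutatorSolutions_apply (hS hL) i j,
          ← Finset.sum_add_sum_compl (insert i A), add_sub_cancel_left, Finset.sum_product]
        refine Finset.sum_congr rfl fun l hl => ?_
        rw [Fintype.sum_bool]
        simp only [wide, crossVec, Matrix.of_apply, hl, if_true]
        rw [hLA j l (Or.inl hj), hLA l j (Or.inr hj)]
        simp
        ring
      have h3 : ∑ l ∈ insert i A, (M i l * M j l - M l i * M l j) =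
          ∑ l ∈ insert i A, (N i l * N j l - N l i * N l j) := by
        refine Finset.sum_congr rfl fun l hl => ?_
        rw [hMA j l (Or.inl hj), hNA j l (Or.inl hj), hMA l j (Or.inr hj), hNA l j (Or.inr hj)]
        rcases Finset.mem_insert.1 hl with rfl | hl
        · rw [hii]
        · rw [hMA i l (Or.inr hl), hNA i l (Or.inr hl), hMA l i (Or.inl hl), hNA l i (Or.inl hl)]
      simp only [Pi.sub_apply, mul_sub, Finset.sum_sub_distrib]
      rw [key M hM hMA, key N hN hNA, h3, sub_self]

/-- Revealing one more row and column when the new vector lies in the row space of the rows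
in `K`, which has dimension `h`. -/
theorem revealCount_insert_le_of_span (S : Finset (Matrix ι ι ℝ)) (hS : S ⊆ signMatrices ι)
    (A K : Finset ι) (hKA : K ⊆ A) (i : ι) (h : ℕ)
    (hK : ∀ M ∈ S, blockRank (wide M) K ((insert i A)ᶜ ×ˢ Finset.univ) = h)
    (hi : ∀ M ∈ S, blockRank (wide M) (insert i K) ((insert i A)ᶜ ×ˢ Finset.univ) ≤ h) :
    revealCount S (insert i A) ≤ (2 * 2 ^ h) * revealCount S A := by
  classical
  apply revealCount_insert_le S hS 1 (Or.inl rfl)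
  intro M₀ hM₀
  refine ⟨rowSpace (wide M₀) K ((insert i A)ᶜ ×ˢ Finset.univ), ?_, ?_⟩
  · rw [← blockRank_eq_finrank_rowSpace, hK M₀ hM₀]
  · have key : ∀ M ∈ S, reveal A M = reveal A M₀ → crossVec 1 (insert i A)ᶜ i M ∈
        rowSpace (wide M₀) K ((insert i A)ᶜ ×ˢ Finset.univ) := by
      intro M hM hMA
      rw [reveal_eq_iff] at hMA
      have h1 : rowSpace (wide M₀) K ((insert i A)ᶜ ×ˢ Finset.univ) =
          rowSpace (wide M) K ((insert i A)ᶜ ×ˢ Finset.univ) := by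
        apply rowSpace_congr
        intro k hk q _
        simp only [wide, Matrix.of_apply]
        rw [hMA _ _ (Or.inl (hKA hk)), hMA _ _ (Or.inr (hKA hk))]
      have h2 : rowSpace (wide M) K ((insert i A)ᶜ ×ˢ Finset.univ) =
          rowSpace (wide M) (insert i K) ((insert i A)ᶜ ×ˢ Finset.univ) := by
        apply Submodule.eq_of_le_of_finrank_le (rowSpace_mono_left _ (Finset.subset_insert _ _) _)
        rw [← blockRank_eq_finrank_rowSpace, ← blockRank_eq_finrank_rowSpace, hK M hM]
        exact hi M hM
      rw [h1, h2]
      apply Submodule.subset_span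
      refine ⟨i, by simp, ?_⟩
      funext q
      simp only [maskVec, wide, crossVec, Matrix.of_apply, Finset.mem_product, Finset.mem_univ,
        and_true, one_mul]
    intro M hM N hN hMA hNA _
    exact Submodule.sub_mem _ (key M hM hMA) (key N hN hNA)

end Reveal

/-! ### Rank certificates and the bound by successive revealing. -/

section Certificate

variable {ι : Type*} [Fintype ι] [DecidableEq ι]

/-- A family `S` of solutions of the commutator equation that share the following data: a set `P`
of indices and a nonsingular square block `K × B` of `wide M`, with `K ⊆ P` and `B` among the
columns outside `P`, whose size is the largest rank of a block `A × Aᶜ`; moreover this rank drops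
when one more index joins `P`. -/
structure IsRankCertificate (C : Matrix ι ι ℝ) (S : Finset (Matrix ι ι ℝ)) (P K : Finset ι)
    (B : Finset (ι × Bool)) : Prop where
  subset : S ⊆ commutatorSolutions C
  rows_subset : K ⊆ P
  cols_subset : B ⊆ Pᶜ ×ˢ Finset.univ
  card_eq : B.card = K.card
  rank_eq : ∀ M ∈ S, blockRank (wide M) K B = K.card
  rank_le : ∀ M ∈ S, ∀ A : Finset ι, blockRank (wide M) A (Aᶜ ×ˢ Finset.univ) ≤ K.card
  rank_lt : ∀ M ∈ S, ∀ i ∈ Pᶜ, blockRank (wide M) P ((Pᶜ.erase i) ×ˢ Finset.univ) < K.card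

/-- The indices outside `P` both of whose columns are in `B`. -/
def doubles (P : Finset ι) (B : Finset (ι × Bool)) : Finset ι :=
  Pᶜ.filter fun i => (i, false) ∈ B ∧ (i, true) ∈ B

/-- The indices outside `P` not both of whose columns are in `B`. -/
def singles (P : Finset ι) (B : Finset (ι × Bool)) : Finset ι :=
  Pᶜ.filter fun i => ¬((i, false) ∈ B ∧ (i, true) ∈ B)

theorem card_singles_add_card_doubles (P : Finset ι) (B : Finset (ι × Bool)) :
    (singles P B).card + (doubles P B).card = Pᶜ.card := by
  rw [add_comm]
  exact Finset.card_filter_add_card_filter_not _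

/-- Each of the n - |A| - 1 remaining indices contributes two unknown entries, and the diagonal
entry one more. A real `r` allows differences that may be negative, without truncated subtraction.
-/
theorem revealCount_insert_le_rpow_of_rank (C : Matrix ι ι ℝ) (S : Finset (Matrix ι ι ℝ))
    (hS : S ⊆ commutatorSolutions C) (A : Finset ι) (i : ι) (hi : i ∉ A) (r : ℝ)
    (hr : ∀ M ∈ S, r ≤ blockRank (wide M) A ((insert i A)ᶜ ×ˢ Finset.univ)) :
    (revealCount S (insert i A) : ℝ) ≤
      2 ^ (2 * ((Fintype.card ι : ℝ) - A.card - 1) + 1 - r) * revealCount S A := by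
  classical
  have hu : ((insert i A)ᶜ.card : ℝ) = (Fintype.card ι : ℝ) - A.card - 1 := by
    have h1 := Finset.card_add_card_compl (insert i A)
    rw [Finset.card_insert_of_notMem hi] at h1
    rw [← h1]
    push_cast
    ring
  rcases S.eq_empty_or_nonempty with rfl | ⟨M, hM⟩
  · simp [revealCount]
  have h1 := revealCount_insert_le_of_rank C S hS A i ⌈r⌉₊ fun M hM => Nat.ceil_le.2 (hr M hM)
  have h2 : ⌈r⌉₊ ≤ 2 * (insert i A)ᶜ.card := by
    rw [← card_prod_bool]
    exact (Nat.ceil_le.2 (hr M hM)).trans (blockRank_le_card_right _ _ _)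
  have h3 : (revealCount S (insert i A) : ℝ) ≤
      (2 * 2 ^ (2 * (insert i A)ᶜ.card - ⌈r⌉₊)) * revealCount S A := by exact_mod_cast h1
  refine h3.trans ?_
  gcongr
  rw [← Real.rpow_natCast, ← Real.rpow_one_add' (by norm_num) (by positivity)]
  apply Real.rpow_le_rpow_of_exponent_le (by norm_num)
  rw [Nat.cast_sub h2]
  push_cast
  rw [hu]
  linarith [Nat.le_ceil r]

namespace IsRankCertificate

variable {C : Matrix ι ι ℝ} {S : Finset (Matrix ι ι ℝ)} {P K : Finset ι} {B : Finset (ι × Bool)}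

theorem card_le_blockRank (H : IsRankCertificate C S P K B) {M : Matrix ι ι ℝ} (hM : M ∈ S)
    {A : Finset ι} (hA : A ⊆ K) : A.card ≤ blockRank (wide M) A B := by
  have h1 := blockRank_le_add_card_left (wide M) K A B
  have h2 := Finset.card_sdiff_add_card_eq_card hA
  have h3 := H.rank_eq M hM
  omega

theorem card_le_blockRank_cols (H : IsRankCertificate C S P K B) {M : Matrix ι ι ℝ} (hM : M ∈ S)
    {B' : Finset (ι × Bool)} (hB : B' ⊆ B) : B'.card ≤ blockRank (wide M) K B' := by
  have h1 := blockRank_le_add_card_right (wide M) K B B'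
  have h2 := Finset.card_sdiff_add_card_eq_card hB
  have h3 := H.rank_eq M hM
  have h4 := H.card_eq
  omega

theorem cols_subset_prod (H : IsRankCertificate C S P K B) {A : Finset ι} (hA : A ⊆ P) :
    B ⊆ Aᶜ ×ˢ Finset.univ :=
  H.cols_subset.trans (Finset.product_subset_product_left (Finset.compl_subset_compl.2 hA))

/-- If `B` avoided both columns of `i`, the block would survive the removal of `i` from Pᶜ, against
`rank_lt`. -/
theorem mem_or_mem (H : IsRankCertificate C S P K B) (hne : S.Nonempty) {i : ι} (hi : i ∈ Pᶜ) :
    (i, false) ∈ B ∨ (i, true) ∈ B := by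
  obtain ⟨M, hM⟩ := hne
  by_contra! hcon
  have h1 : B ⊆ (Pᶜ.erase i) ×ˢ Finset.univ := by
    rintro ⟨j, b⟩ hjb
    have h2 := H.cols_subset hjb
    simp only [Finset.mem_product, Finset.mem_univ, and_true] at h2 ⊢
    refine Finset.mem_erase.2 ⟨?_, h2⟩
    rintro rfl
    cases b
    · exact hcon.1 hjb
    · exact hcon.2 hjb
  have h2 := blockRank_mono (wide M) H.rows_subset h1
  have h3 := H.rank_lt M hM i hi
  have h4 := H.rank_eq M hM
  omega

/-- The identity s + 2d = h: the columns of `B` are counted index by index. -/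
theorem card_rows (H : IsRankCertificate C S P K B) (hne : S.Nonempty) :
    (singles P B).card + 2 * (doubles P B).card = K.card := by
  rw [← H.card_eq]
  have h1 : B.card = ∑ i ∈ Pᶜ, (B.filter fun q => q.1 = i).card := by
    apply Finset.card_eq_sum_card_fiberwise
    intro q hq
    exact (Finset.mem_product.1 (H.cols_subset hq)).1
  have h2 : ∀ i ∈ Pᶜ, (B.filter fun q => q.1 = i).card =
      if (i, false) ∈ B ∧ (i, true) ∈ B then 2 else 1 := by
    intro i hi
    have h3 : (B.filter fun q => q.1 = i) =
        (Finset.univ.filter fun b => (i, b) ∈ B).map ⟨Prod.mk i, Prod.mk_right_injective i⟩ := by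
      ext ⟨j, b⟩
      simp only [Finset.mem_filter, Finset.mem_map, Finset.mem_univ, true_and,
        Function.Embedding.coeFn_mk, Prod.mk.injEq]
      constructor
      · rintro ⟨h, rfl⟩
        exact ⟨b, h, rfl, rfl⟩
      · rintro ⟨b, h, rfl, rfl⟩
        exact ⟨h, rfl⟩
    rw [h3, Finset.card_map, Finset.card_filter, Fintype.sum_bool]
    have := H.mem_or_mem hne hi
    by_cases h4 : (i, false) ∈ B <;> by_cases h5 : (i, true) ∈ B <;> simp_all
  rw [h1, Finset.sum_congr rfl h2, Finset.sum_ite]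
  simp only [Finset.sum_const, smul_eq_mul, mul_one, singles, doubles]
  ring

/-- Rows of a nonsingular block are independent, so after `j` of them there are `j` independent
equations for the next one. -/
theorem revealCount_rows_le (H : IsRankCertificate C S P K B) :
    (revealCount S K : ℝ) ≤
      2 ^ (2 * (Fintype.card ι : ℝ) * K.card - 3 / 2 * (K.card : ℝ) ^ 2 + K.card) := by
  have h1 := Finset.le_two_rpow_of_insert (revealCount S) ∅ K
    (fun j => 2 * (Fintype.card ι : ℝ) * j - 3 / 2 * (j : ℝ) ^ 2 + j)
    (fun j => 2 * ((Fintype.card ι : ℝ) - j - 1) + 1 - j) (by simp) ?_ ?_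
  · rw [Finset.empty_union] at h1
    refine h1.trans (mul_le_of_le_one_right (by positivity) ?_)
    exact_mod_cast revealCount_empty_le S
  · intro k _
    push_cast
    linarith [sq_nonneg (k : ℝ)]
  · intro A hA i hi hiA
    rw [Finset.empty_union]
    refine revealCount_insert_le_rpow_of_rank C S H.subset A i hiA _ fun M hM => ?_
    have h2 := H.card_le_blockRank hM hA
    have h3 := blockRank_mono (wide M) (subset_refl A)
      (H.cols_subset_prod (Finset.insert_subset (H.rows_subset hi) (hA.trans H.rows_subset)))
    exact_mod_cast h2.trans h3

/-- Inside `P` the columns `B` stay available, so the rows in `K` still have rank h. As h is the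
largest possible rank, a further row must lie in their span: h dimensions plus one diagonal entry.
-/
theorem revealCount_union_le_of_span (H : IsRankCertificate C S P K B) {Q : Finset ι}
    (hQ : Q ⊆ P \ K) :
    (revealCount S (K ∪ Q) : ℝ) ≤ 2 ^ (((K.card : ℝ) + 1) * Q.card) * revealCount S K := by
  refine Finset.le_two_rpow_of_insert (revealCount S) K Q
    (fun j => ((K.card : ℝ) + 1) * j) (fun _ => (K.card : ℝ) + 1) (by simp) ?_ ?_
  · intro k _
    push_cast
    linarith
  · intro A hA i hi hiA
    have hAP : insert i (K ∪ A) ⊆ P := by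
      refine Finset.insert_subset (Finset.sdiff_subset (hQ hi)) (Finset.union_subset H.rows_subset ?_)
      exact (hA.trans hQ).trans Finset.sdiff_subset
    have h1 := revealCount_insert_le_of_span S
      (fun M hM => (mem_commutatorSolutions.1 (H.subset hM)).1) (K ∪ A) K
      Finset.subset_union_left i K.card ?_ ?_
    · have h2 : (revealCount S (insert i (K ∪ A)) : ℝ) ≤
          (2 * 2 ^ K.card) * revealCount S (K ∪ A) := by exact_mod_cast h1
      rwa [← pow_succ', ← Real.rpow_natCast, Nat.cast_add, Nat.cast_one] at h2
    · intro M hM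
      apply le_antisymm (blockRank_le_card_left _ _ _)
      rw [← H.rank_eq M hM]
      exact blockRank_mono _ subset_rfl (H.cols_subset_prod hAP)
    · intro M hM
      refine le_trans (blockRank_mono_left _ ?_ _) (H.rank_le M hM (insert i (K ∪ A)))
      exact Finset.insert_subset_insert _ Finset.subset_union_left

/-- The alternative to the span bound for indices of `P \ K`: the rows in `K` supply h independent
equations at every step. It is the cheaper one when few indices remain. -/
theorem revealCount_union_le_of_rank (H : IsRankCertificate C S P K B) {Q R : Finset ι}
    (hKQ : K ⊆ Q) (hQ : Q ⊆ P) (hR : R ⊆ P \ Q) :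
    (revealCount S (Q ∪ R) : ℝ) ≤
      2 ^ (2 * ((Fintype.card ι : ℝ) - Q.card) * R.card - (R.card : ℝ) ^ 2 - K.card * R.card) *
        revealCount S Q := by
  refine Finset.le_two_rpow_of_insert (revealCount S) Q R
    (fun j => 2 * ((Fintype.card ι : ℝ) - Q.card) * j - (j : ℝ) ^ 2 - K.card * j)
    (fun j => 2 * ((Fintype.card ι : ℝ) - (Q.card + j) - 1) + 1 - K.card) (by simp) ?_ ?_
  · intro k _
    push_cast
    linarith
  · intro A hA i hi hiA
    have hiQ : i ∉ Q := (Finset.mem_sdiff.1 (hR hi)).2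
    have hdisj : Disjoint Q A :=
      Finset.disjoint_of_subset_right (hA.trans hR) Finset.disjoint_sdiff
    have hcard : ((Q ∪ A).card : ℝ) = Q.card + A.card := by
      exact_mod_cast Finset.card_union_of_disjoint hdisj
    rw [← hcard]
    refine revealCount_insert_le_rpow_of_rank C S H.subset _ i (by simp [hiQ, hiA]) _
      fun M hM => ?_
    have hAP : insert i (Q ∪ A) ⊆ P :=
      Finset.insert_subset (Finset.sdiff_subset (hR hi))
        (Finset.union_subset hQ ((hA.trans hR).trans Finset.sdiff_subset))
    rw [← H.rank_eq M hM]
    exact_mod_cast blockRank_mono (wide M) (hKQ.trans Finset.subset_union_left)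
      (H.cols_subset_prod hAP)

/-- A single has only one column in `B`, so each single revealed lowers the available rank by at
most one. After `j` singles the exponent of the next step is s - j, and these add up to s(s + 1)/2.
-/
theorem revealCount_union_singles_le (H : IsRankCertificate C S P K B) (hne : S.Nonempty) :
    (revealCount S (P ∪ singles P B) : ℝ) ≤
      2 ^ (((singles P B).card : ℝ) ^ 2 / 2 + (singles P B).card / 2) * revealCount S P := by
  have hcP := Finset.card_add_card_compl P
  have hsd := card_singles_add_card_doubles P B
  have hrows := H.card_rows hne
  have e1 : (P.card : ℝ) + ((singles P B).card + (doubles P B).card) = Fintype.card ι := by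
    exact_mod_cast (by omega : P.card + ((singles P B).card + (doubles P B).card) = Fintype.card ι)
  have e2 : ((singles P B).card : ℝ) + 2 * (doubles P B).card = K.card := by exact_mod_cast hrows
  have h1 := Finset.le_two_rpow_of_insert (revealCount S) P (singles P B)
    (fun j => ((singles P B).card : ℝ) * j - (j : ℝ) ^ 2 / 2 + j / 2)
    (fun j => 2 * ((Fintype.card ι : ℝ) - (P.card + j) - 1) + 1 - (K.card - (j + 1))) (by simp) ?_ ?_
  · convert h1 using 3
    ring
  · intro k _
    push_cast
    linarith
  · intro A hA i hi hiA
    have hsP : ∀ j ∈ singles P B, j ∉ P := fun j hj =>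
      Finset.mem_compl.1 (Finset.mem_filter.1 hj).1
    have hiP : i ∉ P := hsP i hi
    have hdisj : Disjoint P A := by
      rw [Finset.disjoint_right]
      exact fun j hj => hsP j (hA hj)
    have hcard : ((P ∪ A).card : ℝ) = P.card + A.card := by
      exact_mod_cast Finset.card_union_of_disjoint hdisj
    rw [← hcard]
    refine revealCount_insert_le_rpow_of_rank C S H.subset _ i (by simp [hiP, hiA]) _
      fun M hM => ?_
    set R := (insert i (P ∪ A))ᶜ with hR
    have h3 := blockRank_le_add_card_right (wide M) K B (R ×ˢ Finset.univ)
    have h4 : (B \ R ×ˢ Finset.univ).card ≤ A.card + 1 := by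
      rw [← Finset.card_insert_of_notMem hiA]
      apply Finset.card_le_card_of_injOn Prod.fst
      · intro q hq
        simp only [Finset.coe_sdiff, Set.mem_sdiff, Finset.mem_coe, Finset.mem_product,
          Finset.mem_univ, and_true, hR, Finset.mem_compl, not_not] at hq
        have h5 := (Finset.mem_product.1 (H.cols_subset hq.1)).1
        rw [Finset.mem_compl] at h5
        simp only [Finset.mem_insert, Finset.mem_union, h5, false_or] at hq
        simpa using hq.2
      · have hmem : ∀ q ∈ B \ R ×ˢ Finset.univ, q.1 ∈ singles P B := by
          intro q hq
          simp only [Finset.mem_sdiff, Finset.mem_product,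
            Finset.mem_univ, and_true, hR, Finset.mem_compl, not_not] at hq
          have h5 := (Finset.mem_product.1 (H.cols_subset hq.1)).1
          rw [Finset.mem_compl] at h5
          simp only [Finset.mem_insert, Finset.mem_union, h5, false_or] at hq
          rcases hq.2 with h | h
          · rwa [h]
          · exact hA h
        rintro ⟨j, b⟩ hq ⟨j', b'⟩ hq' hjj
        obtain rfl : j = j' := hjj
        have h6 := (Finset.mem_filter.1 (hmem _ hq)).2
        have h7 := (Finset.mem_sdiff.1 hq).1
        have h8 := (Finset.mem_sdiff.1 hq').1
        cases b <;> cases b' <;> simp_all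
    have h5 := H.rank_eq M hM
    have h6 := blockRank_mono_left (wide M)
      (H.rows_subset.trans (Finset.subset_union_left (s₂ := A))) (R ×ˢ Finset.univ)
    have h7 : (K.card : ℝ) ≤ blockRank (wide M) (P ∪ A) (R ×ˢ Finset.univ) + (A.card + 1) := by
      exact_mod_cast (by omega :
        K.card ≤ blockRank (wide M) (P ∪ A) (R ×ˢ Finset.univ) + (A.card + 1))
    linarith

/-- When only doubles remain, all remaining columns lie in `B` and are independent. The equations
then fix every off-diagonal entry, and each step costs just the diagonal one. -/
theorem card_le_revealCount_union_singles (H : IsRankCertificate C S P K B) :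
    (S.card : ℝ) ≤ 2 ^ ((doubles P B).card : ℝ) * revealCount S (P ∪ singles P B) := by
  have hcP := Finset.card_add_card_compl P
  have hsd := card_singles_add_card_doubles P B
  have e1 : (P.card : ℝ) + ((singles P B).card + (doubles P B).card) = Fintype.card ι := by
    exact_mod_cast (by omega : P.card + ((singles P B).card + (doubles P B).card) = Fintype.card ι)
  have hPs : Disjoint P (singles P B) := by
    rw [Finset.disjoint_right]
    exact fun j hj => Finset.mem_compl.1 (Finset.mem_filter.1 hj).1
  have hmem : ∀ j, j ∈ doubles P B ↔ j ∉ P ∪ singles P B := by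
    intro j
    simp only [doubles, singles, Finset.mem_union, Finset.mem_filter, Finset.mem_compl]
    tauto
  have huniv : P ∪ singles P B ∪ doubles P B = Finset.univ := by
    ext j
    have := hmem j
    simp only [Finset.mem_union, Finset.mem_univ, iff_true] at this ⊢
    tauto
  have h1 := Finset.le_two_rpow_of_insert (revealCount S) (P ∪ singles P B) (doubles P B)
    (fun j => (j : ℝ)) (fun j => 1) (by simp) (by intro k _; push_cast; rfl) ?_
  · rwa [huniv, revealCount_univ] at h1
  · intro A hA i hi hiA
    have hi' := (hmem i).1 hi
    have hdisj : Disjoint (P ∪ singles P B) A := by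
      rw [Finset.disjoint_right]
      exact fun j hj => (hmem j).1 (hA hj)
    have hcard : ((P ∪ singles P B ∪ A).card : ℝ) = P.card + (singles P B).card + A.card := by
      rw [Finset.card_union_of_disjoint hdisj, Finset.card_union_of_disjoint hPs]
      push_cast
      rfl
    have hiA' : i ∉ P ∪ singles P B ∪ A := by
      rw [Finset.mem_union]
      tauto
    set R := (insert i (P ∪ singles P B ∪ A))ᶜ with hR
    have hRcard : (R.card : ℝ) = Fintype.card ι - (P ∪ singles P B ∪ A).card - 1 := by
      have h2 := Finset.card_add_card_compl (insert i (P ∪ singles P B ∪ A))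
      rw [Finset.card_insert_of_notMem hiA'] at h2
      rw [hR, ← h2]
      push_cast
      ring
    have h2 := revealCount_insert_le_rpow_of_rank C S H.subset _ i hiA' (2 * R.card)
      fun M hM => ?_
    · convert h2 using 3
      rw [hRcard]
      ring
    · have hRB : R ×ˢ Finset.univ ⊆ B := by
        rintro ⟨j, b⟩ hj
        simp only [hR, Finset.mem_product, Finset.mem_univ, and_true, Finset.mem_compl,
          Finset.mem_insert, not_or] at hj
        have hjd : j ∈ doubles P B := (hmem j).2 fun h => hj.2 (Finset.mem_union_left _ h)
        have := (Finset.mem_filter.1 hjd).2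
        cases b
        · exact this.1
        · exact this.2
      have h3 := H.card_le_blockRank_cols hM hRB
      rw [card_prod_bool] at h3
      have h4 := blockRank_mono_left (wide M) (A' := P ∪ singles P B ∪ A)
        (H.rows_subset.trans (Finset.subset_union_left.trans Finset.subset_union_left))
        (R ×ˢ Finset.univ)
      exact_mod_cast h3.trans h4

/-- The bound obtained by revealing all rows and columns one at a time. -/
theorem card_le_of_reveal (H : IsRankCertificate C S P K B) (hne : S.Nonempty) (s₁ : ℕ)
    (hs₁ : s₁ ≤ (P \ K).card) :
    (S.card : ℝ) ≤ 2 ^ (2 * (Fintype.card ι : ℝ) * K.card - 3 / 2 * (K.card : ℝ) ^ 2 + K.card +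
      ((K.card : ℝ) + 1) * s₁ +
      (2 * ((Fintype.card ι : ℝ) - (K.card + s₁)) * ((P \ K).card - s₁)
        - ((P \ K).card - s₁ : ℝ) ^ 2 - K.card * ((P \ K).card - s₁)) +
      (((singles P B).card : ℝ) ^ 2 / 2 + (singles P B).card / 2) + (doubles P B).card) := by
  obtain ⟨Q, hQ, rfl⟩ := Finset.exists_subset_card_eq hs₁
  have hKQ : Disjoint K Q := Finset.disjoint_of_subset_right hQ Finset.disjoint_sdiff
  have hQP : K ∪ Q ⊆ P := Finset.union_subset H.rows_subset (hQ.trans Finset.sdiff_subset)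
  have h0 := H.card_le_revealCount_union_singles
  have h1 := H.revealCount_union_singles_le hne
  have h2 := H.revealCount_union_le_of_rank (Finset.subset_union_left (s₂ := Q)) hQP subset_rfl
  have h3 := H.revealCount_union_le_of_span hQ
  have h4 := H.revealCount_rows_le
  have e1 : (P \ (K ∪ Q)).card = (P \ K).card - Q.card := by
    rw [← Finset.card_sdiff_of_subset hQ]
    congr 1
    rw [Finset.sdiff_union_distrib]
    ext x
    simp only [Finset.mem_inter, Finset.mem_sdiff]
    tauto
  rw [Finset.union_sdiff_of_subset hQP, e1, Nat.cast_sub hs₁,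
    Finset.card_union_of_disjoint hKQ, Nat.cast_add] at h2
  rw [Real.rpow_add (by norm_num), Real.rpow_add (by norm_num), Real.rpow_add (by norm_num),
    Real.rpow_add (by norm_num)]
  calc (S.card : ℝ) ≤ _ := h0
    _ ≤ _ := mul_le_mul_of_nonneg_left h1 (by positivity)
    _ ≤ _ := by
      refine mul_le_mul_of_nonneg_left (mul_le_mul_of_nonneg_left (h2.trans
        (mul_le_mul_of_nonneg_left (h3.trans (mul_le_mul_of_nonneg_left h4 ?_)) ?_)) ?_) ?_ <;>
        positivity
    _ = _ := by ring

end IsRankCertificate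

end Certificate

/-! ### Linear relations among the columns outside `P`. -/

section Columns

variable {ι : Type*} [Fintype ι] [DecidableEq ι]

/-- Column `q` of `wide M`, restricted to the rows in `P`. -/
def colVec (P : Finset ι) (M : Matrix ι ι ℝ) (q : ι × Bool) : ι → ℝ :=
  maskVec P ((wide M)ᵀ q)

theorem colVec_mem_supportedOn (P : Finset ι) (M : Matrix ι ι ℝ) (q : ι × Bool) :
    colVec P M q ∈ supportedOn P := fun i hi => by simp [colVec, maskVec, hi]

/-- The columns of `wide M` in `Q`, restricted to the rows in `P`. -/
def revealCols (P : Finset ι) (Q : Finset (ι × Bool)) (M : Matrix ι ι ℝ) :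
    ι × Bool → ι → ℝ := fun q => if q ∈ Q then colVec P M q else 0

theorem revealCols_eq_iff {P : Finset ι} {Q : Finset (ι × Bool)} {M N : Matrix ι ι ℝ} :
    revealCols P Q M = revealCols P Q N ↔ ∀ q ∈ Q, colVec P M q = colVec P N q := by
  constructor
  · intro h q hq
    simpa [revealCols, hq] using congrFun h q
  · intro h
    funext q
    by_cases hq : q ∈ Q
    · simpa [revealCols, hq] using h q hq
    · simp [revealCols, hq]

open Classical in
/-- The number of ways in which the columns in `Q` can be filled. -/
noncomputable def colCount (S : Finset (Matrix ι ι ℝ)) (P : Finset ι) (Q : Finset (ι × Bool)) : ℕ :=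
  (S.image (revealCols P Q)).card

theorem colCount_empty_le (S : Finset (Matrix ι ι ℝ)) (P : Finset ι) : colCount S P ∅ ≤ 1 := by
  classical
  unfold colCount
  rw [Finset.card_le_one]
  intro a ha b hb
  obtain ⟨M, -, rfl⟩ := Finset.mem_image.1 ha
  obtain ⟨N, -, rfl⟩ := Finset.mem_image.1 hb
  exact revealCols_eq_iff.2 (by simp)

theorem colCount_insert_le (S : Finset (Matrix ι ι ℝ)) (hS : S ⊆ signMatrices ι) (P : Finset ι)
    (Q : Finset (ι × Bool)) (q : ι × Bool) (δ : ℕ)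
    (h : ∀ M₀ ∈ S, ∃ V : Submodule ℝ (ι → ℝ), Module.finrank ℝ V ≤ δ ∧
      ∀ M ∈ S, (∀ b ∈ Q, colVec P M b = colVec P M₀ b) → colVec P M q ∈ V) :
    colCount S P (insert q Q) ≤ 2 ^ δ * colCount S P Q := by
  classical
  unfold colCount
  apply Finset.card_image_le_mul_card_image
  intro M₀ hM₀
  obtain ⟨V, hV, hmem⟩ := h M₀ hM₀
  refine (Finset.card_image_le_card_image_of_factors _ _ (fun M => colVec P M q) ?_).trans ?_
  · intro M hM N hN hMN
    have h1 := revealCols_eq_iff.1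
      ((Finset.mem_filter.1 hM).2.trans (Finset.mem_filter.1 hN).2.symm)
    rw [revealCols_eq_iff]
    intro b hb
    rcases Finset.mem_insert.1 hb with rfl | hb
    · exact hMN
    · exact h1 b hb
  · have hx : ∀ x ∈ (S.filter fun M => revealCols P Q M = revealCols P Q M₀).image
        (fun M => colVec P M q), ∃ M ∈ S, x = colVec P M q ∧ x ∈ V := by
      intro x hx
      obtain ⟨M, hM, rfl⟩ := Finset.mem_image.1 hx
      obtain ⟨hM, hMQ⟩ := Finset.mem_filter.1 hM
      exact ⟨M, hM, rfl, hmem M hM (revealCols_eq_iff.1 hMQ)⟩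
    refine (card_le_two_pow_finrank _ (fun i => if i ∈ P then 1 else 0) ?_ V ?_).trans
      (Nat.pow_le_pow_right (by norm_num) hV)
    · intro x hx' i
      obtain ⟨M, hM, rfl, -⟩ := hx x hx'
      have hM := mem_signMatrices.1 (hS hM)
      simp only [colVec, maskVec, wide, Matrix.transpose_apply, Matrix.of_apply]
      split_ifs
      · exact hM _ _
      · exact hM _ _
      · simp
    · intro x hx' y hy'
      obtain ⟨M, -, -, h1⟩ := hx x hx'
      obtain ⟨N, -, -, h2⟩ := hx y hy'
      exact Submodule.sub_mem _ h1 h2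

theorem colCount_le (S : Finset (Matrix ι ι ℝ)) (hS : S ⊆ signMatrices ι) (P : Finset ι)
    (Q : Finset (ι × Bool)) : colCount S P Q ≤ 2 ^ (P.card * Q.card) := by
  induction Q using Finset.induction_on with
  | empty => simpa using colCount_empty_le S P
  | insert q Q hq ih =>
    refine (colCount_insert_le S hS P Q q P.card fun _ _ => ⟨supportedOn P,
      finrank_supportedOn_le P, fun M _ _ => colVec_mem_supportedOn P M q⟩).trans ?_
    rw [Finset.card_insert_of_notMem hq, mul_add, mul_one, add_comm, pow_add]
    gcongr

/-- The column of a single index that is not in `B`. -/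
def freeCol (B : Finset (ι × Bool)) (i : ι) : ι × Bool := (i, decide ((i, false) ∈ B))

/-- The coordinates `γ` of column `q` with respect to the columns in `B`. -/
def IsColCoord (P : Finset ι) (B : Finset (ι × Bool)) (M : Matrix ι ι ℝ) (q : ι × Bool)
    (γ : ι × Bool → ℝ) : Prop :=
  (∀ b ∉ B, γ b = 0) ∧ ∑ b, γ b • colVec P M b = colVec P M q

namespace IsRankCertificate

variable {C : Matrix ι ι ℝ} {S : Finset (Matrix ι ι ℝ)} {P K : Finset ι} {B : Finset (ι × Bool)}

theorem blockRank_cols (H : IsRankCertificate C S P K B) {M : Matrix ι ι ℝ} (hM : M ∈ S) :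
    blockRank (wide M) P B = B.card := by
  apply le_antisymm (blockRank_le_card_right _ _ _)
  rw [H.card_eq, ← H.rank_eq M hM]
  exact blockRank_mono_left _ H.rows_subset _

theorem linearIndependent_colVec (H : IsRankCertificate C S P K B) {M : Matrix ι ι ℝ}
    (hM : M ∈ S) : LinearIndependent ℝ (fun b : B => colVec P M b) := by
  rw [linearIndependent_iff_card_eq_finrank_span, Set.finrank, Fintype.card_coe,
    ← H.blockRank_cols hM, ← blockRank_transpose, blockRank_eq_finrank_rowSpace, rowSpace,
    Set.image_eq_range]
  rfl

/-- The columns in `B` are independent. This lets coordinates computed in a reference matrix be used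
for every matrix with the same revealed columns. -/
theorem isColCoord_unique (H : IsRankCertificate C S P K B) {M N : Matrix ι ι ℝ} (hM : M ∈ S)
    {q : ι × Bool} {γ γ' : ι × Bool → ℝ} (hB : ∀ b ∈ B, colVec P M b = colVec P N b)
    (hq : colVec P M q = colVec P N q) (hγ : IsColCoord P B M q γ) (hγ' : IsColCoord P B N q γ') :
    γ = γ' := by
  have h1 : ∑ b ∈ B, (γ b - γ' b) • colVec P M b = 0 := by
    have e1 : ∑ b ∈ B, γ b • colVec P M b = colVec P M q := by
      rw [← hγ.2]
      exact Finset.sum_subset (Finset.subset_univ _) fun b _ hb => by rw [hγ.1 b hb, zero_smul]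
    have e2 : ∑ b ∈ B, γ' b • colVec P M b = colVec P M q := by
      rw [hq, ← hγ'.2, Finset.sum_congr rfl fun b hb => by rw [hB b hb]]
      exact Finset.sum_subset (Finset.subset_univ _) fun b _ hb => by rw [hγ'.1 b hb, zero_smul]
    simp only [sub_smul, Finset.sum_sub_distrib, e1, e2, sub_self]
  rw [← Finset.sum_coe_sort] at h1
  have h2 := Fintype.linearIndependent_iff.1 (H.linearIndependent_colVec hM)
    (fun b => γ b - γ' b) h1
  funext b
  by_cases hb : b ∈ B
  · exact sub_eq_zero.1 (h2 ⟨b, hb⟩)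
  · rw [hγ.1 b hb, hγ'.1 b hb]

/-- The block P × Pᶜ has rank at most h = |B|, so the independent columns in `B` span all its
columns. -/
theorem exists_isColCoord (H : IsRankCertificate C S P K B) {M : Matrix ι ι ℝ} (hM : M ∈ S)
    {q : ι × Bool} (hq : q.1 ∈ Pᶜ) : ∃ γ, IsColCoord P B M q γ := by
  have h1 : rowSpace (wide M)ᵀ B P = rowSpace (wide M)ᵀ (Pᶜ ×ˢ Finset.univ) P := by
    apply Submodule.eq_of_le_of_finrank_le (rowSpace_mono_left _ H.cols_subset _)
    rw [← blockRank_eq_finrank_rowSpace, ← blockRank_eq_finrank_rowSpace, blockRank_transpose,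
      blockRank_transpose, H.blockRank_cols hM, H.card_eq]
    exact H.rank_le M hM P
  have h2 : colVec P M q ∈ rowSpace (wide M)ᵀ B P := by
    rw [h1]
    exact Submodule.subset_span ⟨q, by simpa using hq, rfl⟩
  obtain ⟨g, hg⟩ := (Submodule.mem_span_image_finset_iff_exists_fun ℝ).1 h2
  refine ⟨fun b => if hb : b ∈ B then g ⟨b, hb⟩ else 0, fun b hb => by simp [hb], ?_⟩
  rw [← hg, ← Finset.sum_subset (Finset.subset_univ B)
    (fun b _ hb => by simp [hb]), ← Finset.sum_coe_sort]
  refine Finset.sum_congr rfl fun b _ => ?_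
  simp only [Finset.coe_mem, dif_pos]
  rfl

/-- If the pair `j` is removed, some column of `B` is lost from the column space. -/
theorem exists_notMem_rowSpace (H : IsRankCertificate C S P K B) {M : Matrix ι ι ℝ} (hM : M ∈ S)
    {j : ι} (hj : j ∈ Pᶜ) :
    ∃ b ∈ B, b.1 = j ∧ colVec P M b ∉ rowSpace (wide M)ᵀ ((Pᶜ.erase j) ×ˢ Finset.univ) P := by
  by_contra! hcon
  have h1 : rowSpace (wide M)ᵀ B P ≤ rowSpace (wide M)ᵀ ((Pᶜ.erase j) ×ˢ Finset.univ) P := by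
    rw [rowSpace, Submodule.span_le]
    rintro _ ⟨b, hb, rfl⟩
    by_cases hbj : b.1 = j
    · exact hcon b hb hbj
    · refine Submodule.subset_span ⟨b, ?_, rfl⟩
      have := (Finset.mem_product.1 (H.cols_subset hb)).1
      simp only [Finset.coe_product, Set.mem_prod, Finset.mem_coe, Finset.mem_univ, and_true]
      exact Finset.mem_erase.2 ⟨hbj, this⟩
  have h2 := Submodule.finrank_mono h1
  rw [← blockRank_eq_finrank_rowSpace, ← blockRank_eq_finrank_rowSpace, blockRank_transpose,
      blockRank_transpose, H.blockRank_cols hM, H.card_eq] at h2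
  exact absurd (H.rank_lt M hM j hj) (not_lt.2 h2)

/-- All other terms of the relation, and column `q` itself, belong to indices different from `j`. -/
theorem sum_pair_mem_rowSpace (H : IsRankCertificate C S P K B) {M : Matrix ι ι ℝ}
    {j : ι} {q : ι × Bool} (hq : q.1 ∈ Pᶜ) (hqj : q.1 ≠ j)
    {γ : ι × Bool → ℝ} (hγ : IsColCoord P B M q γ) :
    γ (j, true) • colVec P M (j, true) + γ (j, false) • colVec P M (j, false) ∈
      rowSpace (wide M)ᵀ ((Pᶜ.erase j) ×ˢ Finset.univ) P := by
  have hmem : ∀ b : ι × Bool, b.1 ∈ Pᶜ → b.1 ≠ j →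
      colVec P M b ∈ rowSpace (wide M)ᵀ ((Pᶜ.erase j) ×ˢ Finset.univ) P := by
    intro b hb hbj
    refine Submodule.subset_span ⟨b, ?_, rfl⟩
    simp only [Finset.coe_product, Set.mem_prod, Finset.mem_coe, Finset.mem_univ, and_true]
    exact Finset.mem_erase.2 ⟨hbj, hb⟩
  have h1 := hγ.2
  rw [Fintype.sum_prod_type, ← Finset.add_sum_erase _ _ (Finset.mem_univ j), Fintype.sum_bool] at h1
  rw [eq_sub_of_add_eq h1]
  refine Submodule.sub_mem _ (hmem q hq hqj) (Submodule.sum_mem _ fun l hl =>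
    Submodule.sum_mem _ fun b _ => ?_)
  by_cases hlb : (l, b) ∈ B
  · exact Submodule.smul_mem _ _ (hmem _ (Finset.mem_product.1 (H.cols_subset hlb)).1
      (Finset.mem_erase.1 hl).1)
  · rw [hγ.1 _ hlb, zero_smul]
    exact Submodule.zero_mem _

/-- The only column of `B` at a single `j` is not in the span of the columns away from `j`, while
its multiple by the coefficient is. -/
theorem isColCoord_single_eq_zero (H : IsRankCertificate C S P K B) {M : Matrix ι ι ℝ}
    (hM : M ∈ S) {j : ι} (hj : j ∈ singles P B) {q : ι × Bool} (hq : q.1 ∈ Pᶜ) (hqj : q.1 ≠ j)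
    {γ : ι × Bool → ℝ} (hγ : IsColCoord P B M q γ) (e : Bool) : γ (j, e) = 0 := by
  obtain ⟨hjP, hjB⟩ := Finset.mem_filter.1 hj
  by_contra hne
  have heB : (j, e) ∈ B := by
    by_contra h
    exact hne (hγ.1 _ h)
  have heB' : (j, !e) ∉ B := by
    intro h
    cases e
    · exact hjB ⟨heB, h⟩
    · exact hjB ⟨h, heB⟩
  have h1 := H.sum_pair_mem_rowSpace hq hqj hγ
  have h2 : γ (j, e) • colVec P M (j, e) ∈
      rowSpace (wide M)ᵀ ((Pᶜ.erase j) ×ˢ Finset.univ) P := by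
    have h0 := hγ.1 _ heB'
    cases e
    · simp only [Bool.not_false] at h0
      simpa [h0] using h1
    · simp only [Bool.not_true] at h0
      simpa [h0] using h1
  obtain ⟨⟨k, b⟩, hb, rfl, hnb⟩ := H.exists_notMem_rowSpace hM hjP
  have hbe : b = e := by
    by_contra hbe
    rw [show b = !e from by cases b <;> cases e <;> simp_all] at hb
    exact heB' hb
  subst hbe
  exact hnb ((Submodule.smul_mem_iff _ hne).1 h2)

/-- Modulo the columns away from `j`, the pair at `j` does not vanish, so the combinations that do
vanish form at most a line. Two independent ones would, by Cramer's rule, put both columns of the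
pair into that span. -/
theorem isColCoord_double_parallel (H : IsRankCertificate C S P K B) {M : Matrix ι ι ℝ}
    (hM : M ∈ S) {j : ι} (hj : j ∈ Pᶜ) {q q' : ι × Bool} (hq : q.1 ∈ Pᶜ) (hqj : q.1 ≠ j)
    (hq' : q'.1 ∈ Pᶜ) (hqj' : q'.1 ≠ j) {γ γ' : ι × Bool → ℝ} (hγ : IsColCoord P B M q γ)
    (hγ' : IsColCoord P B M q' γ') :
    γ (j, true) * γ' (j, false) = γ (j, false) * γ' (j, true) := by
  by_contra hne
  set D := γ (j, true) * γ' (j, false) - γ (j, false) * γ' (j, true) with hD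
  have hD0 : D ≠ 0 := sub_ne_zero.2 hne
  have h1 := H.sum_pair_mem_rowSpace hq hqj hγ
  have h2 := H.sum_pair_mem_rowSpace hq' hqj' hγ'
  have h3 : D • colVec P M (j, true) ∈
      rowSpace (wide M)ᵀ ((Pᶜ.erase j) ×ˢ Finset.univ) P := by
    convert Submodule.sub_mem _ (Submodule.smul_mem _ (γ' (j, false)) h1)
      (Submodule.smul_mem _ (γ (j, false)) h2) using 1
    rw [hD]
    module
  have h4 : D • colVec P M (j, false) ∈
      rowSpace (wide M)ᵀ ((Pᶜ.erase j) ×ˢ Finset.univ) P := by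
    convert Submodule.sub_mem _ (Submodule.smul_mem _ (γ (j, true)) h2)
      (Submodule.smul_mem _ (γ' (j, true)) h1) using 1
    rw [hD]
    module
  obtain ⟨⟨k, b⟩, hb, rfl, hnb⟩ := H.exists_notMem_rowSpace hM hj
  cases b
  · exact hnb ((Submodule.smul_mem_iff _ hD0).1 h4)
  · exact hnb ((Submodule.smul_mem_iff _ hD0).1 h3)

end IsRankCertificate

end Columns

/-! ### Slopes along the doubles, and the recursive bound. -/

section Slopes

variable {ι : Type*} [Fintype ι] [LinearOrder ι]

/-- For each double index `j`, `ν j` is the first single index whose free column has a nonzero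
component along the pair `j`, whenever there is one. -/
def IsSlopeCertificate (S : Finset (Matrix ι ι ℝ)) (P : Finset ι) (B : Finset (ι × Bool))
    (ν : ι → Option ι) : Prop :=
  ∀ M ∈ S, ∀ j ∈ doubles P B, ∀ i ∈ singles P B, ∀ γ, IsColCoord P B M (freeCol B i) γ →
    (γ (j, true) ≠ 0 ∨ γ (j, false) ≠ 0) → ∃ i₀ ∈ singles P B, ν j = some i₀ ∧ i₀ ≤ i ∧
      ∃ γ₀, IsColCoord P B M (freeCol B i₀) γ₀ ∧ (γ₀ (j, true) ≠ 0 ∨ γ₀ (j, false) ≠ 0)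

theorem exists_mul_eq_of_parallel {a b a₀ b₀ : ℝ} (h : a * b₀ = b * a₀)
    (h0 : a₀ ≠ 0 ∨ b₀ ≠ 0) : ∃ t, a = t * a₀ ∧ b = t * b₀ := by
  rcases h0 with h0 | h0
  · refine ⟨a / a₀, by field_simp, ?_⟩
    field_simp
    linarith
  · refine ⟨b / b₀, ?_, by field_simp⟩
    field_simp
    linarith

namespace IsRankCertificate

variable {C : Matrix ι ι ℝ} {S : Finset (Matrix ι ι ℝ)} {P K : Finset ι} {B : Finset (ι × Bool)}

theorem mem_compl_of_mem_singles {i : ι} (hi : i ∈ singles P B) : i ∈ Pᶜ :=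
  (Finset.mem_filter.1 hi).1

theorem ne_of_mem_singles_of_mem_doubles {i j : ι} (hi : i ∈ singles P B)
    (hj : j ∈ doubles P B) : i ≠ j := by
  rintro rfl
  exact (Finset.mem_filter.1 hi).2 (Finset.mem_filter.1 hj).2

theorem exists_submodule_freeCol (H : IsRankCertificate C S P K B) {ν : ι → Option ι}
    (hν : IsSlopeCertificate S P B ν) {i : ι} (hi : i ∈ singles P B) {A : Finset ι}
    (hA : ∀ x ∈ singles P B, x < i → x ∈ A) {M₀ : Matrix ι ι ℝ} (hM₀ : M₀ ∈ S) :
    ∃ V : Submodule ℝ (ι → ℝ), Module.finrank ℝ V ≤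
        1 + (doubles P B).card + ((doubles P B).filter fun j => ν j = some i).card ∧
      ∀ M ∈ S, (∀ b ∈ B ∪ A.image (freeCol B), colVec P M b = colVec P M₀ b) →
        colVec P M (freeCol B i) ∈ V := by
  classical
  have hex : ∀ i, ∃ γ, i ∈ singles P B → IsColCoord P B M₀ (freeCol B i) γ := by
    intro i
    by_cases hi : i ∈ singles P B
    · obtain ⟨γ, hγ⟩ := H.exists_isColCoord (q := freeCol B i) hM₀ (mem_compl_of_mem_singles hi)
      exact ⟨γ, fun _ => hγ⟩
    · exact ⟨0, fun h => absurd h hi⟩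
  choose g hg using hex
  let c := colVec P M₀
  -- The direction along the pair `j`, read off in `M₀` from the first free column that meets the
  -- pair. The default 0 is harmless: if `ν j` is `none`, no free column meets the pair.
  let w : ι → ι → ℝ := fun j => (ν j).elim 0 fun i₀ =>
    g i₀ (j, true) • c (j, true) + g i₀ (j, false) • c (j, false)
  let D₁ := (doubles P B).filter fun j => ν j = some i
  let D₂ := (doubles P B).filter fun j => ¬ν j = some i
  -- Generators for free column `i`: its partner in `B`, both columns of each pair first met at `i`,
  -- and one direction for every other pair.
  let F : Finset (ι → ℝ) := {c (i, !decide ((i, false) ∈ B))} ∪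
    ((D₁ ×ˢ (Finset.univ : Finset Bool)).image c ∪ D₂.image w)
  refine ⟨Submodule.span ℝ (F : Set (ι → ℝ)), ?_, ?_⟩
  · have h1 : D₁.card + D₂.card = (doubles P B).card :=
      Finset.card_filter_add_card_filter_not _
    have h2 : F.card ≤ 1 + (2 * D₁.card + D₂.card) := by
      refine (Finset.card_union_le _ _).trans ?_
      rw [Finset.card_singleton]
      gcongr
      refine (Finset.card_union_le _ _).trans ?_
      gcongr
      · rw [← card_prod_bool]
        exact Finset.card_image_le
      · exact Finset.card_image_le
    have h3 := finrank_span_finset_le_card (R := ℝ) F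
    rw [Set.finrank] at h3
    have h4 : ((doubles P B).filter fun j => ν j = some i).card = D₁.card := rfl
    omega
  · intro M hM hMM
    have hcB : ∀ b ∈ B, colVec P M b = c b := fun b hb => hMM b (Finset.mem_union_left _ hb)
    have hF : ∀ v ∈ F, v ∈ Submodule.span ℝ (F : Set (ι → ℝ)) := fun v hv =>
      Submodule.subset_span hv
    obtain ⟨γ, hγ⟩ := H.exists_isColCoord (q := freeCol B i) hM (mem_compl_of_mem_singles hi)
    rw [← hγ.2, Fintype.sum_prod_type]
    refine Submodule.sum_mem _ fun j _ => ?_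
    rw [Fintype.sum_bool]
    have hterm : ∀ e, (j, e) ∉ B → γ (j, e) • colVec P M (j, e) = 0 := fun e he => by
      rw [hγ.1 _ he, zero_smul]
    by_cases hjP : j ∈ Pᶜ
    swap
    · have h1 : ∀ e, (j, e) ∉ B := fun e he =>
        hjP (Finset.mem_product.1 (H.cols_subset he)).1
      rw [hterm _ (h1 _), hterm _ (h1 _), add_zero]
      exact Submodule.zero_mem _
    by_cases hjd : (j, false) ∈ B ∧ (j, true) ∈ B
    · have hjD : j ∈ doubles P B := Finset.mem_filter.2 ⟨hjP, hjd⟩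
      by_cases h0 : γ (j, true) ≠ 0 ∨ γ (j, false) ≠ 0
      swap
      · push Not at h0
        rw [h0.1, h0.2, zero_smul, zero_smul, add_zero]
        exact Submodule.zero_mem _
      obtain ⟨i₀, hi₀, hνj, hle, γ₀, hγ₀, hγ₀0⟩ := hν M hM j hjD i hi γ hγ h0
      rw [hcB _ hjd.1, hcB _ hjd.2]
      rcases hle.eq_or_lt with rfl | hlt
      · have h1 : ∀ e, c (j, e) ∈ F := by
          intro e
          refine Finset.mem_union_right _ (Finset.mem_union_left _ (Finset.mem_image_of_mem _ ?_))
          simpa [D₁] using ⟨hjD, hνj⟩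
        exact Submodule.add_mem _ (Submodule.smul_mem _ _ (hF _ (h1 _)))
          (Submodule.smul_mem _ _ (hF _ (h1 _)))
      · have h1 : w j ∈ F := by
          refine Finset.mem_union_right _ (Finset.mem_union_right _ (Finset.mem_image_of_mem _ ?_))
          simp only [D₂, Finset.mem_filter, hνj, Option.some.injEq]
          exact ⟨hjD, hlt.ne⟩
        have h2 : γ₀ = g i₀ := H.isColCoord_unique hM hcB
          (hMM _ (Finset.mem_union_right _ (Finset.mem_image_of_mem _ (hA i₀ hi₀ hlt)))) hγ₀
          (hg i₀ hi₀)
        obtain ⟨t, ht1, ht2⟩ := exists_mul_eq_of_parallel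
          (H.isColCoord_double_parallel hM hjP (mem_compl_of_mem_singles hi)
            (ne_of_mem_singles_of_mem_doubles hi hjD) (mem_compl_of_mem_singles hi₀)
            (ne_of_mem_singles_of_mem_doubles hi₀ hjD) hγ hγ₀) hγ₀0
        have h3 : γ (j, true) • c (j, true) + γ (j, false) • c (j, false) = t • w j := by
          simp only [w, hνj, Option.elim_some]
          rw [ht1, ht2, h2, smul_add, mul_smul, mul_smul]
        rw [h3]
        exact Submodule.smul_mem _ _ (hF _ h1)
    · have hjS : j ∈ singles P B := Finset.mem_filter.2 ⟨hjP, hjd⟩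
      by_cases hji : j = i
      · subst hji
        have hb : ∀ e, γ (j, e) • colVec P M (j, e) ∈ Submodule.span ℝ (F : Set (ι → ℝ)) := by
          intro e
          by_cases he : (j, e) ∈ B
          · rw [hcB _ he]
            refine Submodule.smul_mem _ _ (hF _ (Finset.mem_union_left _ ?_))
            rw [Finset.mem_singleton]
            congr 2
            cases e
            · simp [he]
            · have : (j, false) ∉ B := fun h => hjd ⟨h, he⟩
              simp [this]
          · rw [hterm e he]
            exact Submodule.zero_mem _
        exact Submodule.add_mem _ (hb _) (hb _)
      · have h1 := H.isColCoord_single_eq_zero hM hjS (q := freeCol B i)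
          (mem_compl_of_mem_singles hi) (Ne.symm hji) hγ
        rw [h1, h1, zero_smul, zero_smul, add_zero]
        exact Submodule.zero_mem _

/-- The free columns are filled in increasing order, so that a slope is known by the time it is
reused. -/
theorem colCount_union_image_le (H : IsRankCertificate C S P K B) {ν : ι → Option ι}
    (hν : IsSlopeCertificate S P B ν) (A : Finset ι) (hA : A ⊆ singles P B)
    (hinit : ∀ x ∈ singles P B, ∀ y ∈ A, x ≤ y → x ∈ A) :
    colCount S P (B ∪ A.image (freeCol B)) ≤
      2 ^ (∑ i ∈ A, (1 + (doubles P B).card + ((doubles P B).filter fun j => ν j = some i).card)) *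
        colCount S P B := by
  induction A using Finset.induction_on_max with
  | empty => simp
  | insert i A hlt ih =>
    have hiA : i ∉ A := fun h => lt_irrefl _ (hlt i h)
    obtain ⟨hi, hA'⟩ := Finset.insert_subset_iff.1 hA
    have ih := ih hA' fun x hx y hy hxy => by
      rcases Finset.mem_insert.1 (hinit x hx y (Finset.mem_insert_of_mem hy) hxy) with rfl | h
      · exact absurd (hlt y hy) (not_lt.2 hxy)
      · exact h
    rw [Finset.image_insert, Finset.union_insert, Finset.sum_insert hiA, pow_add, mul_assoc]
    refine (colCount_insert_le S (fun M hM => (mem_commutatorSolutions.1 (H.subset hM)).1) P _ _ _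
      fun M₀ hM₀ => H.exists_submodule_freeCol hν hi ?_ hM₀).trans
      (Nat.mul_le_mul_left _ ih)
    intro x hx hxi
    exact (Finset.mem_insert.1 (hinit x hx i (Finset.mem_insert_self _ _) hxi.le)).resolve_left
      hxi.ne

theorem colCount_compl_le (H : IsRankCertificate C S P K B) (hne : S.Nonempty) {ν : ι → Option ι}
    (hν : IsSlopeCertificate S P B ν) :
    colCount S P (Pᶜ ×ˢ Finset.univ) ≤ 2 ^ (P.card * K.card +
      ((singles P B).card * (1 + (doubles P B).card) + (doubles P B).card)) := by
  classical
  have h1 : Pᶜ ×ˢ Finset.univ = B ∪ (singles P B).image (freeCol B) := by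
    ext ⟨j, e⟩
    simp only [Finset.mem_product, Finset.mem_univ, and_true, Finset.mem_union, Finset.mem_image]
    constructor
    · intro hj
      by_cases he : (j, e) ∈ B
      · exact Or.inl he
      · refine Or.inr ⟨j, Finset.mem_filter.2 ⟨hj, ?_⟩, ?_⟩
        · rintro ⟨h1, h2⟩
          cases e
          · exact he h1
          · exact he h2
        · have := H.mem_or_mem hne hj
          unfold freeCol
          cases e <;> simp_all
    · rintro (h | ⟨i, hi, hij⟩)
      · exact (Finset.mem_product.1 (H.cols_subset h)).1
      · obtain ⟨rfl, -⟩ := Prod.mk.inj hij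
        exact mem_compl_of_mem_singles hi
  have h2 := H.colCount_union_image_le hν (singles P B) subset_rfl fun x hx _ _ _ => hx
  have h3 := colCount_le S (fun M hM => (mem_commutatorSolutions.1 (H.subset hM)).1) P B
  rw [h1]
  refine h2.trans ((Nat.mul_le_mul_left _ h3).trans ?_)
  rw [← pow_add, add_comm, H.card_eq]
  refine Nat.pow_le_pow_right (by norm_num) (Nat.add_le_add_left ?_ _)
  rw [Finset.sum_add_distrib, Finset.sum_const, smul_eq_mul]
  refine Nat.add_le_add_left ?_ _
  -- A pair is first met by at most one free column, so the extra dimensions total at most d.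
  rw [← Finset.card_biUnion]
  · refine Finset.card_le_card fun j hj => ?_
    obtain ⟨i, -, hj⟩ := Finset.mem_biUnion.1 hj
    exact (Finset.mem_filter.1 hj).1
  · intro i _ i' _ hii
    rw [Function.onFun, Finset.disjoint_left]
    intro j hj hj'
    have e1 := (Finset.mem_filter.1 hj).2
    have e2 := (Finset.mem_filter.1 hj').2
    rw [e1] at e2
    exact hii (Option.some.inj e2)

end IsRankCertificate

theorem card_commutatorSolutions_le_of_equiv {α β : Type*} [Fintype α] [DecidableEq α] [Fintype β]
    [DecidableEq β] (e : α ≃ β) (C : Matrix α α ℝ) :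
    (commutatorSolutions C).card ≤ (commutatorSolutions (Matrix.reindex e e C)).card := by
  apply Finset.card_le_card_of_injOn (Matrix.reindex e e)
  · intro M hM
    obtain ⟨h1, h2⟩ := mem_commutatorSolutions.1 hM
    refine mem_commutatorSolutions.2 ⟨mem_signMatrices.2 fun i j => ?_, ?_⟩
    · exact mem_signMatrices.1 h1 _ _
    · have := congrArg (Matrix.reindex e e) h2
      simp only [Matrix.reindex_apply, Matrix.transpose_submatrix, Matrix.submatrix_mul_equiv] at this ⊢
      rw [this]
      rfl
  · exact (Matrix.reindex e e).injective.injOn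

namespace IsRankCertificate

variable {C : Matrix ι ι ℝ} {S : Finset (Matrix ι ι ℝ)} {P K : Finset ι} {B : Finset (ι × Bool)}

/-- With the entries between `P` and Pᶜ fixed, their contribution to the equations is constant. The
P × P block then solves a commutator equation with right side `C'`, which is why the induction must
cover arbitrary `C`. -/
theorem revealCount_le_mul_colCount (hS : S ⊆ commutatorSolutions C) (P : Finset ι) (N : ℕ)
    (hN : ∀ C' : Matrix (Fin P.card) (Fin P.card) ℝ, (commutatorSolutions C').card ≤ N) :
    revealCount S P ≤ N * colCount S P (Pᶜ ×ˢ Finset.univ) := by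
  classical
  unfold revealCount colCount
  apply Finset.card_image_le_mul_card_image
  intro M₀ hM₀
  let φ : Matrix ι ι ℝ → Matrix P P ℝ := fun M => M.submatrix Subtype.val Subtype.val
  let C' : Matrix P P ℝ := Matrix.of fun i j =>
    C i j - ∑ l ∈ Pᶜ, (M₀ i l * M₀ j l - M₀ l i * M₀ l j)
  have hagree : ∀ M, revealCols P (Pᶜ ×ˢ Finset.univ) M = revealCols P (Pᶜ ×ˢ Finset.univ) M₀ →
      ∀ i ∈ P, ∀ l ∈ Pᶜ, M i l = M₀ i l ∧ M l i = M₀ l i := by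
    intro M hM i hi l hl
    rw [revealCols_eq_iff] at hM
    constructor
    · simpa [colVec, maskVec, wide, hi] using congrFun (hM (l, false) (by simpa using hl)) i
    · simpa [colVec, maskVec, wide, hi] using congrFun (hM (l, true) (by simpa using hl)) i
  refine (Finset.card_image_le_card_image_of_factors _ _ φ ?_).trans ?_
  · intro M hM N hN hMN
    have hM' := hagree M (Finset.mem_filter.1 hM).2
    have hN' := hagree N (Finset.mem_filter.1 hN).2
    rw [reveal_eq_iff]
    intro i j hij
    by_cases hi : i ∈ P
    · by_cases hj : j ∈ P
      · exact congrFun (congrFun hMN ⟨i, hi⟩) ⟨j, hj⟩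
      · have hj : j ∈ Pᶜ := Finset.mem_compl.2 hj
        rw [(hM' i hi j hj).1, (hN' i hi j hj).1]
    · have hj := hij.resolve_left hi
      have hi : i ∈ Pᶜ := Finset.mem_compl.2 hi
      rw [(hM' j hj i hi).2, (hN' j hj i hi).2]
  · have hsub : (S.filter fun M => revealCols P (Pᶜ ×ˢ Finset.univ) M =
        revealCols P (Pᶜ ×ˢ Finset.univ) M₀).image φ ⊆ commutatorSolutions C' := by
      intro x hx
      obtain ⟨M, hM, rfl⟩ := Finset.mem_image.1 hx
      obtain ⟨hM, hMM⟩ := Finset.mem_filter.1 hM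
      have hag := hagree M hMM
      refine mem_commutatorSolutions.2 ⟨mem_signMatrices.2 fun i j =>
        mem_signMatrices.1 (mem_commutatorSolutions.1 (hS hM)).1 _ _, ?_⟩
      ext i j
      have h1 := commutatorSolutions_apply (hS hM) i j
      rw [← Finset.sum_add_sum_compl P] at h1
      have h2 : ∑ l ∈ Pᶜ, (M i l * M j l - M l i * M l j) =
          ∑ l ∈ Pᶜ, (M₀ i l * M₀ j l - M₀ l i * M₀ l j) := by
        refine Finset.sum_congr rfl fun l hl => ?_
        rw [(hag i i.2 l hl).1, (hag i i.2 l hl).2, (hag j j.2 l hl).1, (hag j j.2 l hl).2]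
      rw [h2, ← Finset.sum_coe_sort P, Finset.sum_sub_distrib] at h1
      simp only [Matrix.mul_apply, Matrix.transpose_apply, Matrix.add_apply, C', Matrix.of_apply, φ,
        Matrix.submatrix_apply]
      linarith
    have e : P ≃ Fin P.card := P.equivFin
    exact (Finset.card_le_card hsub).trans ((card_commutatorSolutions_le_of_equiv e C').trans (hN _))

/-- The bound obtained by revealing first the columns outside `P`, then the block `P × P`. -/
theorem card_le_of_recursion (H : IsRankCertificate C S P K B) (hne : S.Nonempty)
    {ν : ι → Option ι} (hν : IsSlopeCertificate S P B ν) (N : ℕ)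
    (hN : ∀ C' : Matrix (Fin P.card) (Fin P.card) ℝ, (commutatorSolutions C').card ≤ N) :
    (S.card : ℝ) ≤ 2 ^ ((P.card : ℝ) * K.card + ((singles P B).card * (1 + (doubles P B).card) +
      (doubles P B).card) + (((singles P B).card : ℝ) ^ 2 / 2 + (singles P B).card / 2) +
      (doubles P B).card) * N := by
  have h0 := H.card_le_revealCount_union_singles
  have h1 := H.revealCount_union_singles_le hne
  have h2 : (revealCount S P : ℝ) ≤ N * (2 : ℝ) ^ ((P.card : ℝ) * K.card +
      ((singles P B).card * (1 + (doubles P B).card) + (doubles P B).card)) := by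
    have := (revealCount_le_mul_colCount H.subset P N hN).trans
      (Nat.mul_le_mul_left _ (H.colCount_compl_le hne hν))
    have h3 : (revealCount S P : ℝ) ≤ N * (2 : ℝ) ^ (P.card * K.card +
      ((singles P B).card * (1 + (doubles P B).card) + (doubles P B).card)) := by
      exact_mod_cast this
    rw [← Real.rpow_natCast] at h3
    push_cast at h3
    exact h3
  rw [Real.rpow_add (by norm_num), Real.rpow_add (by norm_num)]
  calc (S.card : ℝ) ≤ _ := h0
    _ ≤ _ := mul_le_mul_of_nonneg_left h1 (by positivity)
    _ ≤ _ := by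
      refine mul_le_mul_of_nonneg_left (mul_le_mul_of_nonneg_left h2 ?_) ?_ <;> positivity
    _ = _ := by ring

end IsRankCertificate

end Slopes

/-! ### Numerical comparison of the two exponents. -/

section Optimization

/-- The first alternative is the revealing exponent, in which (n - 2h)² is the gain from n - 2h span
steps; the second is the recursive one. The first increases with t for t ≥ h/2, the second decreases
with t and increases with h ≤ n. It is therefore enough to split the range of h and compare t with a
threshold on each piece. -/
theorem reveal_or_recursion_of_two_mul_le {n h t : ℝ} (hn : 0 ≤ n) (h2 : h ≤ 2 * t)
    (hth : t ≤ h) (hhn : 2 * h ≤ n) :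
    n ^ 2 - h * n + h ^ 2 + t ^ 2 - h * t - (n - 2 * h) ^ 2 ≤ 0.698 * n ^ 2 ∨
      (0.303 * n ≤ t ∧ n * h - h ^ 2 / 2 + 0.698 * (n - t) ^ 2 ≤ 0.698 * n ^ 2) := by
  have hh : 0 ≤ h := by linarith
  have key : ∀ l : ℝ, (t ≤ l * n → t ^ 2 - h * t ≤ (l * n) ^ 2 - h * (l * n)) := fun l hl => by
    nlinarith [mul_nonneg (sub_nonneg.2 hl) (by linarith : (0 : ℝ) ≤ l * n + t - h)]
  have key2 : ∀ l : ℝ, (l * n ≤ t → (n - t) ^ 2 ≤ (n - l * n) ^ 2) := fun l hl => by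
    nlinarith [mul_nonneg (sub_nonneg.2 hl) (by linarith : (0 : ℝ) ≤ 2 * n - l * n - t)]
  have key3 : ∀ c : ℝ, c ≤ 1 → h ≤ c * n → n * h - h ^ 2 / 2 ≤ (c - c ^ 2 / 2) * n ^ 2 :=
    fun c hc hl => by
      have : c * n ≤ n := by nlinarith
      nlinarith [mul_nonneg (sub_nonneg.2 hl) (by linarith : (0 : ℝ) ≤ n - (c * n + h) / 2)]
  rcases le_total h (0.4687 * n) with c1 | c1
  · rcases le_total t (0.303 * n) with l1 | l1
    · left
      -- At t = 0.303 n the quadratic in h peaks at h = 0.4495 n, with value just below 0.698 n².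
      nlinarith [key _ l1, sq_nonneg (h - 0.4495 * n), sq_nonneg n]
    · right
      refine ⟨l1, ?_⟩
      nlinarith [key2 _ l1, key3 _ (by norm_num) c1, sq_nonneg n]
  rcases le_total h (0.48 * n) with c2 | c2
  · rcases le_total t (0.31 * n) with l1 | l1
    · left
      nlinarith [key _ l1, mul_nonneg (sub_nonneg.2 c1) hn, mul_nonneg (sub_nonneg.2 c1) hh,
        sq_nonneg n, mul_nonneg (sub_nonneg.2 c1) (sub_nonneg.2 c1)]
    · right
      refine ⟨by linarith, ?_⟩
      nlinarith [key2 _ l1, key3 _ (by norm_num) c2, sq_nonneg n]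
  · rcases le_total t (0.32 * n) with l1 | l1
    · left
      nlinarith [key _ l1, mul_nonneg (sub_nonneg.2 c2) hn, mul_nonneg (sub_nonneg.2 c2) hh,
        sq_nonneg n, mul_nonneg (sub_nonneg.2 c2) (sub_nonneg.2 c2)]
    · right
      refine ⟨by linarith, ?_⟩
      nlinarith [key2 _ l1, key3 (1 / 2) (by norm_num) (by linarith), sq_nonneg n]

/-- Here span steps bring no gain. The hypotheses give h ≤ 2n/3, which bounds the range to be split.
-/
theorem reveal_or_recursion_of_le_two_mul {n h t : ℝ} (hn : 0 ≤ n) (h2 : h ≤ 2 * t)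
    (htn : h + t ≤ n) (hhn : n ≤ 2 * h) :
    n ^ 2 - h * n + h ^ 2 + t ^ 2 - h * t ≤ 0.698 * n ^ 2 ∨
      (0.303 * n ≤ t ∧ n * h - h ^ 2 / 2 + 0.698 * (n - t) ^ 2 ≤ 0.698 * n ^ 2) := by
  have key : ∀ l : ℝ, (t ≤ l * n → t ^ 2 - h * t ≤ (l * n) ^ 2 - h * (l * n)) := fun l hl => by
    nlinarith [mul_nonneg (sub_nonneg.2 hl) (by linarith : (0 : ℝ) ≤ l * n + t - h)]
  have key2 : ∀ l : ℝ, (l * n ≤ t → (n - t) ^ 2 ≤ (n - l * n) ^ 2) := fun l hl => by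
    nlinarith [mul_nonneg (sub_nonneg.2 hl) (by linarith : (0 : ℝ) ≤ 2 * n - l * n - t)]
  have key3 : ∀ c : ℝ, c ≤ 1 → h ≤ c * n → n * h - h ^ 2 / 2 ≤ (c - c ^ 2 / 2) * n ^ 2 :=
    fun c hc hl => by
      have : c * n ≤ n := by nlinarith
      nlinarith [mul_nonneg (sub_nonneg.2 hl) (by linarith : (0 : ℝ) ≤ n - (c * n + h) / 2)]
  have c3 : h ≤ (2 / 3) * n := by linarith
  rcases le_total h (0.55 * n) with c1 | c1
  · rcases le_total t (0.35 * n) with l1 | l1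
    · left
      nlinarith [key _ l1, mul_nonneg (sub_nonneg.2 hhn) (sub_nonneg.2 c1), sq_nonneg n,
        mul_nonneg (sub_nonneg.2 hhn) hn]
    · right
      refine ⟨by linarith, ?_⟩
      nlinarith [key2 _ l1, key3 _ (by norm_num) c1, sq_nonneg n]
  · rcases le_total t (0.4 * n) with l1 | l1
    · left
      nlinarith [key _ l1, mul_nonneg (sub_nonneg.2 c1) (sub_nonneg.2 c3), sq_nonneg n,
        mul_nonneg (sub_nonneg.2 c1) hn]
    · right
      refine ⟨by linarith, ?_⟩
      nlinarith [key2 _ l1, key3 _ (by norm_num) c3, sq_nonneg n]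

end Optimization

/-! ### Every solution has a certificate. -/

section Existence

variable {ι : Type*} [Fintype ι] [LinearOrder ι]

/-- `P` is a set of maximal size among those maximizing the rank. Enlarging it must lower the rank,
which is `rank_lt`. -/
theorem exists_isRankCertificate {C M : Matrix ι ι ℝ} (hM : M ∈ commutatorSolutions C) :
    ∃ (P K : Finset ι) (B : Finset (ι × Bool)), IsRankCertificate C {M} P K B := by
  classical
  let f : Finset ι → ℕ := fun A => blockRank (wide M) A (Aᶜ ×ˢ Finset.univ)
  obtain ⟨P₀, -, hP₀⟩ := Finset.exists_max_image Finset.univ f Finset.univ_nonempty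
  obtain ⟨P, hP, hPmax⟩ := Finset.exists_max_image
    (Finset.univ.filter fun A => f A = f P₀) Finset.card ⟨P₀, by simp⟩
  have hfP : f P = f P₀ := (Finset.mem_filter.1 hP).2
  obtain ⟨K, hKP, hK, hKr⟩ := exists_rows_card_eq_blockRank (wide M) P (Pᶜ ×ˢ Finset.univ)
  obtain ⟨B, hB, hBc, hBr⟩ := exists_cols_card_eq_blockRank (wide M) K (Pᶜ ×ˢ Finset.univ)
  have hKf : K.card = f P := hK
  refine ⟨P, K, B, by simpa using hM, hKP, hB, by omega, ?_, ?_, ?_⟩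
  · rintro _ hN
    rw [Finset.mem_singleton.1 hN]
    omega
  · rintro _ hN A
    rw [Finset.mem_singleton.1 hN, hKf, hfP]
    exact hP₀ A (Finset.mem_univ _)
  · rintro _ hN i hi
    rw [Finset.mem_singleton.1 hN]
    by_contra! hcon
    have hiP : i ∉ P := Finset.mem_compl.1 hi
    have h1 : f (insert i P) = f P₀ := by
      apply le_antisymm (hP₀ _ (Finset.mem_univ _))
      rw [← hfP, ← hKf]
      refine hcon.trans (blockRank_mono _ (Finset.subset_insert _ _) ?_)
      apply Finset.product_subset_product_left
      intro j hj
      rw [Finset.mem_erase, Finset.mem_compl] at hj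
      simpa using hj
    have h2 := hPmax (insert i P) (by simpa using h1)
    rw [Finset.card_insert_of_notMem hiP] at h2
    omega

theorem exists_isSlopeCertificate (M : Matrix ι ι ℝ) (P : Finset ι) (B : Finset (ι × Bool)) :
    ∃ ν : ι → Option ι, IsSlopeCertificate {M} P B ν := by
  classical
  let I : ι → Finset ι := fun j => (singles P B).filter fun i =>
    ∃ γ, IsColCoord P B M (freeCol B i) γ ∧ (γ (j, true) ≠ 0 ∨ γ (j, false) ≠ 0)
  refine ⟨fun j => if h : (I j).Nonempty then some ((I j).min' h) else none, ?_⟩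
  intro N hN j _ i hi γ hγ hne
  rw [Finset.mem_singleton.1 hN] at hγ ⊢
  have hiI : i ∈ I j := Finset.mem_filter.2 ⟨hi, γ, hγ, hne⟩
  have hI : (I j).Nonempty := ⟨i, hiI⟩
  obtain ⟨h1, h2⟩ := Finset.mem_filter.1 ((I j).min'_mem hI)
  exact ⟨(I j).min' hI, h1, by simp [hI], Finset.min'_le _ _ hiI, h2⟩

open Classical in
/-- The solutions that admit the given certificate. -/
noncomputable def certified (C : Matrix ι ι ℝ) (P K : Finset ι) (B : Finset (ι × Bool))
    (ν : ι → Option ι) : Finset (Matrix ι ι ℝ) :=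
  (commutatorSolutions C).filter fun M =>
    IsRankCertificate C {M} P K B ∧ IsSlopeCertificate {M} P B ν

theorem isRankCertificate_certified {C : Matrix ι ι ℝ} {P K : Finset ι} {B : Finset (ι × Bool)}
    {ν : ι → Option ι} (hne : (certified C P K B ν).Nonempty) :
    IsRankCertificate C (certified C P K B ν) P K B := by
  classical
  have h : ∀ M ∈ certified C P K B ν, IsRankCertificate C {M} P K B := fun M hM =>
    (Finset.mem_filter.1 hM).2.1
  obtain ⟨M₀, hM₀⟩ := hne
  have H := h M₀ hM₀
  exact ⟨Finset.filter_subset _ _, H.rows_subset, H.cols_subset, H.card_eq,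
    fun M hM => (h M hM).rank_eq M (by simp), fun M hM => (h M hM).rank_le M (by simp),
    fun M hM => (h M hM).rank_lt M (by simp)⟩

theorem isSlopeCertificate_certified (C : Matrix ι ι ℝ) (P K : Finset ι) (B : Finset (ι × Bool))
    (ν : ι → Option ι) : IsSlopeCertificate (certified C P K B ν) P B ν := by
  classical
  exact fun M hM => (Finset.mem_filter.1 hM).2.2 M (by simp)

end Existence

/-! ### Induction on the size and union bound over certificates. -/

section Induction

/-- The error term in the exponent of the bound for the number of solutions. -/
noncomputable def errorTerm (n : ℕ) : ℝ := 27 * n * Real.logb 2 (n + 2)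

theorem one_le_logb_two_add_two (n : ℕ) : 1 ≤ Real.logb 2 ((n : ℝ) + 2) := by
  rw [Real.le_logb_iff_rpow_le (by norm_num) (by positivity), Real.rpow_one]
  linarith [(Nat.cast_nonneg n : (0 : ℝ) ≤ n)]

theorem card_certified_le {n : ℕ}
    (ih : ∀ p < n, ∀ C : Matrix (Fin p) (Fin p) ℝ,
      ((commutatorSolutions C).card : ℝ) ≤ 2 ^ (0.698 * (p : ℝ) ^ 2 + errorTerm p)) (hn : 0 < n)
    (C : Matrix (Fin n) (Fin n) ℝ) (P K : Finset (Fin n)) (B : Finset (Fin n × Bool))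
    (ν : Fin n → Option (Fin n)) :
    ((certified C P K B ν).card : ℝ) ≤
      2 ^ (0.698 * (n : ℝ) ^ 2 + 3 * n + 0.697 * errorTerm n) := by
  rcases (certified C P K B ν).eq_empty_or_nonempty with h0 | hne
  · rw [h0]
    simp only [Finset.card_empty, Nat.cast_zero]
    positivity
  have H := isRankCertificate_certified hne
  have hν := isSlopeCertificate_certified C P K B ν
  have hcP := Finset.card_add_card_compl P
  have hsd := card_singles_add_card_doubles P B
  have hrows := H.card_rows hne
  have hKP := Finset.card_le_card H.rows_subset
  rw [Fintype.card_fin] at hcP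
  have hPK : (P \ K).card = P.card - K.card := Finset.card_sdiff_of_subset H.rows_subset
  have hn0 : (0 : ℝ) < n := by exact_mod_cast hn
  have hL := one_le_logb_two_add_two n
  have hE0 : 0 ≤ errorTerm n := by unfold errorTerm; positivity
  have F₁ := H.card_le_of_reveal hne
  have F₃ := fun N => H.card_le_of_recursion hne hν N
  rw [Fintype.card_fin] at F₁
  rw [hPK] at F₁
  obtain ⟨s, hs⟩ : ∃ s, s = (singles P B).card := ⟨_, rfl⟩
  obtain ⟨d, hd⟩ : ∃ d, d = (doubles P B).card := ⟨_, rfl⟩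
  obtain ⟨p, hp⟩ : ∃ p, p = P.card := ⟨_, rfl⟩
  obtain ⟨h, hh⟩ : ∃ h, h = K.card := ⟨_, rfl⟩
  simp only [← hs, ← hd, ← hp, ← hh] at F₁ F₃ hcP hsd hrows hKP hPK
  have e1 : (h : ℝ) = s + 2 * d := by exact_mod_cast hrows.symm
  have e2 : (p : ℝ) = n - (s + d) := by
    have : p + (s + d) = n := by omega
    rw [← this]
    push_cast
    ring
  have hhp : (h : ℝ) ≤ p := by exact_mod_cast hKP
  have hs0 : (0 : ℝ) ≤ s := Nat.cast_nonneg s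
  have hd0 : (0 : ℝ) ≤ d := Nat.cast_nonneg d
  have finish_recursion : 0.303 * (n : ℝ) ≤ s + d →
      n * (h : ℝ) - (h : ℝ) ^ 2 / 2 + 0.698 * (n - (s + d)) ^ 2 ≤ 0.698 * (n : ℝ) ^ 2 →
      ((certified C P K B ν).card : ℝ) ≤
        2 ^ (0.698 * (n : ℝ) ^ 2 + 3 * n + 0.697 * errorTerm n) := by
    intro ht hF
    have hpn : p < n := by
      have : (p : ℝ) < n := by rw [e2]; linarith
      exact_mod_cast this
    have h1 := F₃ ⌊(2 : ℝ) ^ (0.698 * (p : ℝ) ^ 2 + errorTerm p)⌋₊ fun C' =>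
      Nat.le_floor ((ih P.card (hp ▸ hpn) C').trans_eq (by rw [hp]))
    refine h1.trans ((mul_le_mul_of_nonneg_left (Nat.floor_le (by positivity)) (by positivity)).trans ?_)
    rw [← Real.rpow_add (by norm_num)]
    apply Real.rpow_le_rpow_of_exponent_le (by norm_num)
    -- Recursion is used only when t ≥ 0.303 n, so the size shrinks by the factor 0.697; the rest of
    -- the error term pays for the certificates.
    have hEp : errorTerm p ≤ 0.697 * errorTerm n := by
      have hp0 : (0 : ℝ) ≤ p := Nat.cast_nonneg p
      have hlog : Real.logb 2 ((p : ℝ) + 2) ≤ Real.logb 2 ((n : ℝ) + 2) := by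
        apply Real.logb_le_logb_of_le (by norm_num) (by positivity)
        have : (p : ℝ) ≤ n := by exact_mod_cast hpn.le
        linarith
      have hp' : (p : ℝ) ≤ 0.697 * n := by rw [e2]; linarith
      unfold errorTerm
      calc 27 * (p : ℝ) * Real.logb 2 (p + 2) ≤ 27 * p * Real.logb 2 (n + 2) := by gcongr
        _ ≤ 27 * (0.697 * n) * Real.logb 2 (n + 2) := by gcongr
        _ = _ := by ring
    rw [e2] at hhp ⊢
    rw [e1] at hF hhp ⊢
    nlinarith
  have finish_reveal : ∀ s₁ : ℕ, s₁ ≤ p - h →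
      2 * (n : ℝ) * h - 3 / 2 * (h : ℝ) ^ 2 + h * s₁ +
        (2 * ((n : ℝ) - (h + s₁)) * (p - h - s₁) - (p - h - s₁ : ℝ) ^ 2 - h * (p - h - s₁)) +
        (s : ℝ) ^ 2 / 2 ≤ 0.698 * (n : ℝ) ^ 2 →
      ((certified C P K B ν).card : ℝ) ≤
        2 ^ (0.698 * (n : ℝ) ^ 2 + 3 * n + 0.697 * errorTerm n) := by
    intro s₁ hs₁ hF
    refine (F₁ s₁ hs₁).trans (Real.rpow_le_rpow_of_exponent_le (by norm_num) ?_)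
    rw [Nat.cast_sub hKP]
    have hs₁' : (s₁ : ℝ) ≤ p - h := by
      rw [← Nat.cast_sub hKP]
      exact_mod_cast hs₁
    linarith
  have hhn : (0 : ℝ) ≤ h := Nat.cast_nonneg h
  rcases le_total (2 * h) n with h2n | h2n
  · have h2n' : 2 * (h : ℝ) ≤ n := by exact_mod_cast h2n
    rcases reveal_or_recursion_of_two_mul_le (t := (s : ℝ) + d) hn0.le (by linarith)
      (by linarith) h2n' with hF | ⟨hF1, hF2⟩
    -- To leading order, span steps are cheaper as long as fewer than n - h indices are known; h of
    -- these are in `K`.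
    · refine finish_reveal (n - 2 * h) (by omega) ?_
      rw [Nat.cast_sub h2n]
      push_cast
      rw [e2]
      have e3 : (s : ℝ) = 2 * (s + d) - h := by linarith
      rw [e1] at hF ⊢
      nlinarith
    · exact finish_recursion hF1 hF2
  · have h2n' : (n : ℝ) ≤ 2 * h := by exact_mod_cast h2n
    rcases reveal_or_recursion_of_le_two_mul (t := (s : ℝ) + d) hn0.le (by linarith)
      (by linarith) h2n' with hF | ⟨hF1, hF2⟩
    · refine finish_reveal 0 (by omega) ?_
      rw [e2]
      rw [e1] at hF ⊢
      push_cast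
      nlinarith
    · exact finish_recursion hF1 hF2

theorem card_commutatorSolutions_le (n : ℕ) (C : Matrix (Fin n) (Fin n) ℝ) :
    ((commutatorSolutions C).card : ℝ) ≤ 2 ^ (0.698 * (n : ℝ) ^ 2 + errorTerm n) := by
  classical
  induction n using Nat.strong_induction_on with
  | _ n ih =>
    rcases Nat.eq_zero_or_pos n with rfl | hn
    · have : (commutatorSolutions C).card ≤ 1 := Finset.card_le_one_of_subsingleton _
      simpa [errorTerm] using this
    let Cert := Finset (Fin n) × Finset (Fin n) × Finset (Fin n × Bool) × (Fin n → Option (Fin n))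
    have hcover : commutatorSolutions C ⊆ (Finset.univ : Finset Cert).biUnion fun c =>
        certified C c.1 c.2.1 c.2.2.1 c.2.2.2 := by
      intro M hM
      obtain ⟨P, K, B, H⟩ := exists_isRankCertificate hM
      obtain ⟨ν, hν⟩ := exists_isSlopeCertificate M P B
      rw [Finset.mem_biUnion]
      exact ⟨(P, K, B, ν), Finset.mem_univ _, Finset.mem_filter.2 ⟨hM, H, hν⟩⟩
    have h1 : ((commutatorSolutions C).card : ℝ) ≤ (Fintype.card Cert : ℝ) *
        2 ^ (0.698 * (n : ℝ) ^ 2 + 3 * n + 0.697 * errorTerm n) := by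
      calc ((commutatorSolutions C).card : ℝ) ≤
          ∑ c : Cert, ((certified C c.1 c.2.1 c.2.2.1 c.2.2.2).card : ℝ) := by
            exact_mod_cast (Finset.card_le_card hcover).trans Finset.card_biUnion_le
        _ ≤ ∑ _c : Cert, 2 ^ (0.698 * (n : ℝ) ^ 2 + 3 * n + 0.697 * errorTerm n) :=
            Finset.sum_le_sum fun c _ => card_certified_le ih hn C _ _ _ _
        _ = _ := by rw [Finset.sum_const, nsmul_eq_mul, Finset.card_univ]
    have hL := one_le_logb_two_add_two n
    have hn0 : (0 : ℝ) < n := by exact_mod_cast hn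
    have h2 : (Fintype.card Cert : ℝ) ≤ 2 ^ (4 * n + n * Real.logb 2 ((n : ℝ) + 2)) := by
      have e : Fintype.card Cert = 2 ^ (4 * n) * (n + 1) ^ n := by
        simp only [Cert, Fintype.card_prod, Fintype.card_finset, Fintype.card_fin,
          Fintype.card_bool, Fintype.card_fun, Fintype.card_option]
        ring
      rw [e, Real.rpow_add (by norm_num), mul_comm (n : ℝ) (Real.logb _ _),
        Real.rpow_mul (by norm_num) (Real.logb 2 ((n : ℝ) + 2)) (n : ℝ), Real.rpow_logb (by norm_num) (by norm_num) (by positivity),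
        Real.rpow_natCast]
      push_cast
      gcongr
      · rw [← Real.rpow_natCast]
        push_cast
        rfl
      · norm_num
    refine h1.trans ((mul_le_mul_of_nonneg_right h2 (by positivity)).trans ?_)
    rw [← Real.rpow_add (by norm_num)]
    apply Real.rpow_le_rpow_of_exponent_le (by norm_num)
    unfold errorTerm
    -- With L = log₂(n + 2) ≥ 1, the certificates and linear terms cost 7n + nL ≤ 8nL, and 0.303 ·
    -- 27 > 8.
    nlinarith [mul_le_mul_of_nonneg_left hL hn0.le]

end Induction

/-! ### From counting to probability. -/

section Probability

theorem rademacherLaw_singleton {a : ℝ} (ha : a = 1 ∨ a = -1) : rademacherLaw {a} = 2⁻¹ := by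
  rcases ha with rfl | rfl <;> simp [rademacherLaw] <;> norm_num

theorem rademacherLaw_compl : rademacherLaw {a | ¬(a = 1 ∨ a = -1)} = 0 := by
  simp [rademacherLaw]

instance isProbabilityMeasure_rademacherLaw : IsProbabilityMeasure rademacherLaw :=
  ⟨by simp [rademacherLaw, ENNReal.inv_two_add_inv_two]⟩

theorem measurableSet_pm_one : MeasurableSet {a : ℝ | ¬(a = 1 ∨ a = -1)} := by
  have : {a : ℝ | ¬(a = 1 ∨ a = -1)} = ({1, -1} : Set ℝ)ᶜ := by ext; simp
  rw [this]
  exact (Set.toFinite _).measurableSet.compl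

/-- By independence the joint law is a product measure; it gives each sign matrix mass 2^(-n²), and
almost surely the matrix is a sign matrix. -/
theorem IsRademacherMatrix.measureReal_eq {Ω : Type*} [MeasurableSpace Ω] {n : ℕ}
    {M : Ω → Matrix (Fin n) (Fin n) ℝ} {μ : Measure Ω} [IsProbabilityMeasure μ]
    (hM : IsRademacherMatrix M μ) (C : Matrix (Fin n) (Fin n) ℝ) :
    μ.real {ω | M ω * (M ω)ᵀ = (M ω)ᵀ * M ω + C} =
      (commutatorSolutions C).card * (2 : ℝ) ^ (-(n : ℝ) ^ 2) := by
  classical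
  let X : Ω → Fin n × Fin n → ℝ := fun ω p => M ω p.1 p.2
  have hX : ∀ p : Fin n × Fin n, AEMeasurable (fun ω => M ω p.1 p.2) μ := fun p =>
    (hM.law p.1 p.2).aemeasurable
  have hXm : AEMeasurable X μ := aemeasurable_pi_iff.2 hX
  have hmap : μ.map X = Measure.pi fun _ => rademacherLaw := by
    rw [(iIndepFun_iff_map_fun_eq_pi_map hX).1 hM.indep]
    congr 1
    funext p
    exact (hM.law p.1 p.2).map_eq
  let u : Matrix (Fin n) (Fin n) ℝ → Fin n × Fin n → ℝ := fun N p => N p.1 p.2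
  have hu : Function.Injective u := fun N N' h => by
    ext i j
    exact congrFun h (i, j)
  let F : Finset (Fin n × Fin n → ℝ) := (commutatorSolutions C).image u
  have hsign : ∀ᵐ ω ∂μ, ∀ i j, M ω i j = 1 ∨ M ω i j = -1 := by
    rw [ae_all_iff]
    intro i
    rw [ae_all_iff]
    intro j
    rw [ae_iff, ← rademacherLaw_compl]
    exact (hM.law i j).measure_eq measurableSet_pm_one
  have hae : {ω | M ω * (M ω)ᵀ = (M ω)ᵀ * M ω + C} =ᵐ[μ] X ⁻¹' (F : Set _) := by
    filter_upwards [hsign] with ω hω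
    apply propext
    constructor
    · intro h
      exact Finset.mem_coe.2 (Finset.mem_image.2
        ⟨M ω, mem_commutatorSolutions.2 ⟨mem_signMatrices.2 hω, h⟩, rfl⟩)
    · intro h
      obtain ⟨N, hN, hNω⟩ := Finset.mem_image.1 (Finset.mem_coe.1 h)
      have hNM : N = M ω := hu hNω
      rw [hNM] at hN
      exact (mem_commutatorSolutions.1 hN).2
  have hatom : ∀ f ∈ F, (Measure.pi fun _ : Fin n × Fin n => rademacherLaw) {f} =
      2⁻¹ ^ (n * n) := by
    intro f hf
    obtain ⟨N, hN, rfl⟩ := Finset.mem_image.1 hf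
    rw [Measure.pi_singleton, Finset.prod_congr rfl fun p _ => rademacherLaw_singleton
      (mem_signMatrices.1 (mem_commutatorSolutions.1 hN).1 p.1 p.2)]
    simp
  rw [measureReal_def, measure_congr hae,
    ← Measure.map_apply_of_aemeasurable hXm F.finite_toSet.measurableSet, hmap,
    ← sum_measure_singleton, Finset.sum_congr rfl hatom, Finset.sum_const,
    Finset.card_image_of_injective _ hu, nsmul_eq_mul, ENNReal.toReal_mul, ENNReal.toReal_natCast,
    ENNReal.toReal_pow, ENNReal.toReal_inv, ENNReal.toReal_ofNat, Real.rpow_neg (by norm_num),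
    inv_pow, ← Real.rpow_natCast]
  push_cast
  rw [sq]

/-- Symmetric matrices are normal, and a symmetric sign matrix is a free choice of sign for each
unordered pair of indices. -/
theorem two_pow_choose_le_card_commutatorSolutions (n : ℕ) :
    2 ^ (n + 1).choose 2 ≤ (commutatorSolutions (0 : Matrix (Fin n) (Fin n) ℝ)).card := by
  classical
  have h1 : (Finset.univ : Finset (Sym2 (Fin n) → Bool)).card = 2 ^ (n + 1).choose 2 := by
    rw [Finset.card_univ, Fintype.card_fun, Sym2.card, Fintype.card_fin, Fintype.card_bool]
  rw [← h1]
  apply Finset.card_le_card_of_injOn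
    (fun g => Matrix.of fun i j => if g s(i, j) then (1 : ℝ) else -1)
  · intro g _
    refine mem_commutatorSolutions.2 ⟨mem_signMatrices.2 fun i j => ?_, ?_⟩
    · simp only [Matrix.of_apply]
      split_ifs <;> simp
    · have : (Matrix.of fun i j => if g s(i, j) then (1 : ℝ) else -1)ᵀ =
          Matrix.of fun i j => if g s(i, j) then (1 : ℝ) else -1 := by
        ext i j
        simp [Sym2.eq_swap (a := j)]
      rw [this, add_zero]
  · intro g _ g' _ h
    funext z
    induction z using Sym2.ind with
    | _ i j =>
      have := congrFun (congrFun h i) j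
      simp only [Matrix.of_apply] at this
      cases hg : g s(i, j) <;> cases hg' : g' s(i, j) <;> simp [hg, hg'] at this ⊢ <;> norm_num at this

theorem tendsto_errorTerm_div_sq :
    Tendsto (fun n : ℕ => -(errorTerm n / (n : ℝ) ^ 2)) atTop (𝓝 0) := by
  -- The limit of log x / (x - 2), taken along x = n + 2, is that of log(n + 2) / n.
  have h1 := (Real.tendsto_pow_log_div_mul_add_atTop 1 (-2) 1 one_ne_zero).comp
    (tendsto_atTop_add_const_right atTop (2 : ℝ) tendsto_natCast_atTop_atTop)
  have h2 := (h1.const_mul (27 / Real.log 2)).neg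
  rw [mul_zero, neg_zero] at h2
  refine h2.congr' ?_
  filter_upwards [eventually_gt_atTop 0] with n hn
  have hn0 : (n : ℝ) ≠ 0 := by exact_mod_cast hn.ne'
  have hl : Real.log 2 ≠ 0 := (Real.log_pos (by norm_num)).ne'
  simp only [Function.comp_apply, errorTerm, Real.logb, pow_one]
  rw [show 1 * ((n : ℝ) + 2) + -2 = n by ring]
  field_simp

theorem IsRademacherMatrix.measureReal_le {Ω : Type*} [MeasurableSpace Ω] {n : ℕ}
    {M : Ω → Matrix (Fin n) (Fin n) ℝ} {μ : Measure Ω} [IsProbabilityMeasure μ]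
    (hM : IsRademacherMatrix M μ) (C : Matrix (Fin n) (Fin n) ℝ) :
    μ.real {ω | M ω * (M ω)ᵀ = (M ω)ᵀ * M ω + C} ≤
      (2 : ℝ) ^ (-(0.302 + -(errorTerm n / (n : ℝ) ^ 2)) * (n : ℝ) ^ 2) := by
  rw [hM.measureReal_eq C]
  refine (mul_le_mul_of_nonneg_right (card_commutatorSolutions_le n C) (by positivity)).trans ?_
  rw [← Real.rpow_add (by norm_num)]
  apply Real.rpow_le_rpow_of_exponent_le (by norm_num)
  have h : errorTerm n / (n : ℝ) ^ 2 * (n : ℝ) ^ 2 = errorTerm n := by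
    -- At n = 0 the quotient is 0 by convention, which is consistent because the error term vanishes
    -- there.
    rcases Nat.eq_zero_or_pos n with rfl | hn
    · simp [errorTerm]
    · have hn0 : (n : ℝ) ≠ 0 := by exact_mod_cast hn.ne'
      field_simp
  linarith

theorem IsRademacherMatrix.le_measureReal {Ω : Type*} [MeasurableSpace Ω] {n : ℕ}
    {M : Ω → Matrix (Fin n) (Fin n) ℝ} {μ : Measure Ω} [IsProbabilityMeasure μ]
    (hM : IsRademacherMatrix M μ) :
    (2 : ℝ) ^ (-(0.5 + 0) * (n : ℝ) ^ 2) ≤ μ.real {ω | M ω * (M ω)ᵀ = (M ω)ᵀ * M ω} := by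
  have h := hM.measureReal_eq 0
  simp only [add_zero] at h
  rw [h]
  have h1 : (2 : ℝ) ^ ((n + 1).choose 2) ≤
      (commutatorSolutions (0 : Matrix (Fin n) (Fin n) ℝ)).card := by
    exact_mod_cast two_pow_choose_le_card_commutatorSolutions n
  refine le_trans ?_ (mul_le_mul_of_nonneg_right h1 (by positivity))
  rw [← Real.rpow_natCast 2 ((n + 1).choose 2), ← Real.rpow_add (by norm_num),
    Nat.cast_choose_two]
  apply Real.rpow_le_rpow_of_exponent_le (by norm_num)
  push_cast
  nlinarith [(Nat.cast_nonneg n : (0 : ℝ) ≤ n)]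

end Probability

theorem theorem1p1 :
    (∃ e : ℕ → ℝ, Tendsto e atTop (𝓝 0) ∧
      ∀ (n : ℕ) (C : Matrix (Fin n) (Fin n) ℝ)
        (Ω : Type*) [MeasurableSpace Ω] (μ : Measure Ω) [IsProbabilityMeasure μ]
        (M : Ω → Matrix (Fin n) (Fin n) ℝ), IsRademacherMatrix M μ →
        μ.real {ω | M ω * (M ω)ᵀ = (M ω)ᵀ * M ω + C}
          ≤ (2 : ℝ) ^ (-(0.302 + e n) * (n : ℝ) ^ 2)) ∧
    (∃ e₁ e₂ : ℕ → ℝ, Tendsto e₁ atTop (𝓝 0) ∧ Tendsto e₂ atTop (𝓝 0) ∧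
      ∀ (n : ℕ)
        (Ω : Type*) [MeasurableSpace Ω] (μ : Measure Ω) [IsProbabilityMeasure μ]
        (M : Ω → Matrix (Fin n) (Fin n) ℝ), IsRademacherMatrix M μ →
        (2 : ℝ) ^ (-(0.5 + e₁ n) * (n : ℝ) ^ 2)
          ≤ μ.real {ω | M ω * (M ω)ᵀ = (M ω)ᵀ * M ω} ∧
        μ.real {ω | M ω * (M ω)ᵀ = (M ω)ᵀ * M ω}
          ≤ (2 : ℝ) ^ (-(0.302 + e₂ n) * (n : ℝ) ^ 2)) := by
  refine ⟨⟨_, tendsto_errorTerm_div_sq, fun n C Ω _ μ _ M hM => hM.measureReal_le C⟩,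
    ⟨fun _ => 0, _, tendsto_const_nhds, tendsto_errorTerm_div_sq, fun n Ω _ μ _ M hM =>
      ⟨hM.le_measureReal, ?_⟩⟩⟩
  have h := hM.measureReal_le 0
  simpa only [add_zero] using h
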